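/- All spaces are complex. A Banach couple $\mathbf X=(X_0,X_1)$ is a pair of Banach spaces continuously embedded in a common Hausdorff topological vector space; $X_0+X_1$ carries the norm $\|x\|_{X_0+X_1}=\inf\{\|a\|_{X_0}+\|b\|_{X_1}: x=a+b\}$. Let $\mathcal F(\mathbf X)$ be the space of continuous functions $f:\{z\in\mathbb C: 1\le|z|\le e\}\to X_0+X_1$ that are analytic on $\{1<|z|<e\}$, $X_0$-valued and $X_0$-continuous on $|z|=1$, and $X_1$-valued and $X_1$-continuous on $|z|=e$, normed by $\|f\|_{\mathcal F}=\max_{j=0,1}\max_{|z|=e^j}\|f(z)\|_{X_j}$. For $0\le\theta\le1$ let $[X_0,X_1]_\theta=\{f(e^\theta): f\in\mathcal F(\mathbf X)\}$, with the norm $\|x\|=\inf\{\|f\|_{\mathcal F}: f\in\mathcal F(\mathbf X),\ f(e^\theta)=x\}$. A Banach space $X$ is called a UMD space if the Riesz projection $\sum_{k\in\mathbb Z}\hat f(k)z^k\mapsto\sum_{k\ge0}\hat f(k)z^k$ is a bounded operator on $L_2(\mathbb T,X)$, where $\mathbb T$ is the unit circle with normalized Haar measure and $\hat f(k)=\int_0^{2\pi}f(e^{it})e^{-ikt}\,\frac{dt}{2\pi}$.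 **Theorem.** Let $\mathbf X=(X_0,X_1)$ and $\mathbf Y=(Y_0,Y_1)$ be Banach couples, with $X_0$ a UMD space. Let $T:X_0+X_1\to Y_0+Y_1$ be a linear operator that maps $X_j$ boundedly into $Y_j$ for $j=0,1$, and suppose that $T:X_0\to Y_0$ is compact. Then for every $0<\theta<1$ the operator $T$ maps $[X_0,X_1]_\theta$ boundedly into $[Y_0,Y_1]_\theta$, and $T:[X_0,X_1]_\theta\to[Y_0,Y_1]_\theta$ is compact. -/

import Mathlib

noncomputable section

/-! ### The image of a Banach space under a continuous linear map, with the quotient norm -/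

section ImageSpace

variable {V E : Type*} [NormedAddCommGroup V] [NormedSpace ℂ V]
  [AddCommGroup E] [Module ℂ E] [TopologicalSpace E]

/-- The range of a continuous linear map `f : V → E`; it is given the norm
`‖y‖ = inf {‖v‖ : f v = y}` below (and not the topology of `E`). -/
def ImageSpace (f : V →L[ℂ] E) : Type _ := ↥(LinearMap.range (f : V →ₗ[ℂ] E))

namespace ImageSpace

variable (f : V →L[ℂ] E)

instance : AddCommGroup (ImageSpace f) :=
  inferInstanceAs (AddCommGroup ↥(LinearMap.range (f : V →ₗ[ℂ] E)))

instance : Module ℂ (ImageSpace f) :=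
  inferInstanceAs (Module ℂ ↥(LinearMap.range (f : V →ₗ[ℂ] E)))

/-- The inclusion of the image in `E`. -/
def val : ImageSpace f →ₗ[ℂ] E := (LinearMap.range (f : V →ₗ[ℂ] E)).subtype

/-- The map `f` with its codomain restricted to the image. -/
def mk : V →ₗ[ℂ] ImageSpace f := (f : V →ₗ[ℂ] E).rangeRestrict

theorem val_injective : Function.Injective (val f) := Subtype.val_injective

@[simp] theorem val_mk (v : V) : val f (mk f v) = f v := rfl

theorem mk_surjective : Function.Surjective (mk f) :=
  LinearMap.surjective_rangeRestrict _

/-- The canonical algebraic isomorphism of the image with the quotient by the kernel. -/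
def toQuot : ImageSpace f ≃ₗ[ℂ] V ⧸ (LinearMap.ker (f : V →ₗ[ℂ] E)) :=
  (f : V →ₗ[ℂ] E).quotKerEquivRange.symm

theorem toQuot_mk (v : V) : toQuot f (mk f v) = Submodule.Quotient.mk v := by
  exact (f : V →ₗ[ℂ] E).quotKerEquivRange.symm_apply_apply (Submodule.Quotient.mk v)

variable [T2Space E]

instance isClosed_ker :
    IsClosed ((LinearMap.ker (f : V →ₗ[ℂ] E) : Submodule ℂ V) : Set V) :=
  f.isClosed_ker

instance : NormedAddCommGroup (ImageSpace f) :=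
  NormedAddCommGroup.induced (ImageSpace f) (V ⧸ (LinearMap.ker (f : V →ₗ[ℂ] E)))
    (toQuot f).toLinearMap (toQuot f).injective

instance : NormedSpace ℂ (ImageSpace f) :=
  NormedSpace.induced ℂ (ImageSpace f) (V ⧸ (LinearMap.ker (f : V →ₗ[ℂ] E)))
    (toQuot f).toLinearMap

/-- The norm of the image space is the infimum of the norms of the preimages. -/
theorem norm_eq (y : ImageSpace f) : ‖y‖ = sInf (norm '' {v : V | f v = val f y}) := by
  obtain ⟨v₀, rfl⟩ := mk_surjective f y
  have hnorm : ‖mk f v₀‖ = ‖(Submodule.Quotient.mk v₀ : V ⧸ LinearMap.ker (f : V →ₗ[ℂ] E))‖ := by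
    rw [← toQuot_mk]
    rfl
  have hq : ∀ v : V, (Submodule.Quotient.mk v : V ⧸ LinearMap.ker (f : V →ₗ[ℂ] E)) =
      Submodule.Quotient.mk v₀ ↔ f v = f v₀ := by
    intro v
    rw [Submodule.Quotient.eq, LinearMap.mem_ker, map_sub, sub_eq_zero]
    rfl
  have hne : (norm '' {v : V | f v = val f (mk f v₀)}).Nonempty := ⟨_, v₀, rfl, rfl⟩
  refine le_antisymm (le_csInf hne ?_) ?_
  · rintro _ ⟨v, hv, rfl⟩
    rw [hnorm, ← (hq v).2 hv]
    exact Submodule.Quotient.norm_mk_le _ v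
  · refine le_of_forall_pos_le_add fun ε hε => ?_
    obtain ⟨v, hv, hlt⟩ := Submodule.Quotient.norm_mk_lt
      (Submodule.Quotient.mk v₀ : V ⧸ LinearMap.ker (f : V →ₗ[ℂ] E)) hε
    rw [hnorm]
    refine le_trans (csInf_le ⟨0, ?_⟩ ⟨v, (hq v).1 hv, rfl⟩) hlt.le
    rintro _ ⟨w, _, rfl⟩
    exact norm_nonneg w

theorem norm_mk_le (v : V) : ‖mk f v‖ ≤ ‖v‖ := by
  rw [norm_eq]
  refine csInf_le ⟨0, ?_⟩ ⟨v, rfl, rfl⟩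
  rintro _ ⟨w, _, rfl⟩
  exact norm_nonneg w

end ImageSpace

end ImageSpace

/-! ### Banach couples -/

/-- A (complex) Banach couple: two complex Banach spaces, continuously embedded in a common
Hausdorff topological vector space `E`. -/
structure BanachCouple (X₀ X₁ E : Type*)
    [NormedAddCommGroup X₀] [NormedSpace ℂ X₀] [CompleteSpace X₀]
    [NormedAddCommGroup X₁] [NormedSpace ℂ X₁] [CompleteSpace X₁]
    [AddCommGroup E] [Module ℂ E] [TopologicalSpace E] [IsTopologicalAddGroup E]
    [ContinuousSMul ℂ E] [T2Space E] where
  /-- the embedding of the first space -/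
  ι₀ : X₀ →L[ℂ] E
  /-- the embedding of the second space -/
  ι₁ : X₁ →L[ℂ] E
  ι₀_injective : Function.Injective ι₀
  ι₁_injective : Function.Injective ι₁

/-- The open annulus `{z : 1 < |z| < e}`. -/
def openAnnulus : Set ℂ := {z | 1 < ‖z‖ ∧ ‖z‖ < Real.exp 1}

/-- The closed annulus `{z : 1 ≤ |z| ≤ e}`. -/
def closedAnnulus : Set ℂ := {z | 1 ≤ ‖z‖ ∧ ‖z‖ ≤ Real.exp 1}

theorem isClosed_closedAnnulus : IsClosed closedAnnulus :=
  (isClosed_le continuous_const continuous_norm).inter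
    (isClosed_le continuous_norm continuous_const)

/-- The circle `|z| = 1` lies in the closed annulus. -/
def innerPt (z : Metric.sphere (0 : ℂ) 1) : closedAnnulus :=
  ⟨z, by
    have hz : ‖(z : ℂ)‖ = 1 := mem_sphere_zero_iff_norm.1 z.2
    have he : (1 : ℝ) ≤ Real.exp 1 := Real.one_le_exp zero_le_one
    exact ⟨hz.ge, hz.le.trans he⟩⟩

/-- The circle `|z| = e` lies in the closed annulus. -/
def outerPt (z : Metric.sphere (0 : ℂ) (Real.exp 1)) : closedAnnulus :=
  ⟨z, by
    have hz : ‖(z : ℂ)‖ = Real.exp 1 := mem_sphere_zero_iff_norm.1 z.2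
    have he : (1 : ℝ) ≤ Real.exp 1 := Real.one_le_exp zero_le_one
    exact ⟨he.trans hz.ge, hz.le⟩⟩

/-- The point `e ^ θ` of the closed annulus, for `0 ≤ θ ≤ 1`. -/
def expPt (θ : Set.Icc (0 : ℝ) 1) : closedAnnulus :=
  ⟨((Real.exp θ : ℝ) : ℂ), by
    have h : ‖((Real.exp θ : ℝ) : ℂ)‖ = Real.exp θ := by
      rw [Complex.norm_real, Real.norm_eq_abs, abs_of_pos (Real.exp_pos _)]
    exact ⟨(Real.one_le_exp θ.2.1).trans h.ge, h.le.trans (Real.exp_le_exp.2 θ.2.2)⟩⟩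

/-- A function on the closed annulus is analytic on the open annulus (the value of the extension
by zero outside the closed annulus is irrelevant). -/
def IsAnalyticInside {V : Type*} [NormedAddCommGroup V] [NormedSpace ℂ V]
    (f : closedAnnulus → V) : Prop :=
  DifferentiableOn ℂ (Function.extend Subtype.val f 0) openAnnulus

/-- The maximum modulus principle on the annulus. -/
theorem IsAnalyticInside.norm_le {V : Type*} [NormedAddCommGroup V] [NormedSpace ℂ V]
    {f : C(closedAnnulus, V)} (hf : IsAnalyticInside f) {c : ℝ}
    (h₀ : ∀ z, ‖f (innerPt z)‖ ≤ c) (h₁ : ∀ z, ‖f (outerPt z)‖ ≤ c) (z : closedAnnulus) :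
    ‖f z‖ ≤ c := by
  have hext : ∀ w : closedAnnulus, Function.extend Subtype.val f 0 (w : ℂ) = f w :=
    fun w => Subtype.val_injective.extend_apply _ _ w
  have hb : ∀ w : ℂ, ∀ hw : w ∈ closedAnnulus, ‖w‖ = 1 ∨ ‖w‖ = Real.exp 1 →
      ‖f ⟨w, hw⟩‖ ≤ c := by
    rintro w hw (h | h)
    · exact h₀ ⟨w, mem_sphere_zero_iff_norm.2 h⟩
    · exact h₁ ⟨w, mem_sphere_zero_iff_norm.2 h⟩
  by_cases hz : (z : ℂ) ∈ openAnnulus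
  · have hsub : closure openAnnulus ⊆ closedAnnulus :=
      closure_minimal (fun w hw => ⟨hw.1.le, hw.2.le⟩) isClosed_closedAnnulus
    have hbdd : Bornology.IsBounded openAnnulus :=
      Metric.isBounded_closedBall.subset
        (fun w hw => mem_closedBall_zero_iff.2 hw.2.le :
          openAnnulus ⊆ Metric.closedBall 0 (Real.exp 1))
    have hcont : ContinuousOn (Function.extend Subtype.val f 0) closedAnnulus := by
      rw [continuousOn_iff_continuous_domRestrict]
      have : closedAnnulus.domRestrict (Function.extend Subtype.val f 0) = f := funext hext
      rw [this]
      exact f.continuous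
    have hfr : ∀ w ∈ frontier openAnnulus, ‖Function.extend Subtype.val f 0 w‖ ≤ c := by
      intro w hw
      have hw' : w ∈ closedAnnulus := hsub (frontier_subset_closure hw)
      rw [hext ⟨w, hw'⟩]
      apply hb w hw'
      have h1 : w ∈ norm ⁻¹' frontier (Set.Ioo (1 : ℝ) (Real.exp 1)) :=
        continuous_norm.frontier_preimage_subset _ hw
      rw [frontier_Ioo (Real.one_lt_exp_iff.2 one_pos)] at h1
      exact h1
    have := Complex.norm_le_of_forall_mem_frontier_norm_le hbdd ⟨hf, hcont.mono hsub⟩ hfr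
      (subset_closure hz)
    rwa [hext z] at this
  · refine hb z z.2 ?_
    by_contra hne
    push Not at hne
    exact hz ⟨lt_of_le_of_ne z.2.1 hne.1.symm, lt_of_le_of_ne z.2.2 hne.2⟩

namespace BanachCouple

variable {X₀ X₁ E : Type*}
  [NormedAddCommGroup X₀] [NormedSpace ℂ X₀] [CompleteSpace X₀]
  [NormedAddCommGroup X₁] [NormedSpace ℂ X₁] [CompleteSpace X₁]
  [AddCommGroup E] [Module ℂ E] [TopologicalSpace E] [IsTopologicalAddGroup E]
  [ContinuousSMul ℂ E] [T2Space E] (C : BanachCouple X₀ X₁ E)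

/-- The map `(a, b) ↦ a + b` from the `ℓ¹`-direct sum of `X₀` and `X₁` to `E`. -/
def sumMap : WithLp 1 (X₀ × X₁) →L[ℂ] E :=
  (C.ι₀.coprod C.ι₁).comp (WithLp.prodContinuousLinearEquiv 1 ℂ X₀ X₁).toContinuousLinearMap

/-- The space `X₀ + X₁ ⊆ E`, with the norm `inf {‖a‖ + ‖b‖ : x = a + b}`. -/
abbrev SumSpace : Type _ := ImageSpace C.sumMap

/-- The inclusion `X₀ ⊆ X₀ + X₁`. -/
def incl₀ : X₀ →ₗ[ℂ] C.SumSpace :=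
  ImageSpace.mk C.sumMap ∘ₗ (WithLp.linearEquiv 1 ℂ (X₀ × X₁)).symm.toLinearMap ∘ₗ
    LinearMap.inl ℂ X₀ X₁

/-- The inclusion `X₁ ⊆ X₀ + X₁`. -/
def incl₁ : X₁ →ₗ[ℂ] C.SumSpace :=
  ImageSpace.mk C.sumMap ∘ₗ (WithLp.linearEquiv 1 ℂ (X₀ × X₁)).symm.toLinearMap ∘ₗ
    LinearMap.inr ℂ X₀ X₁

theorem val_incl₀ (x : X₀) : ImageSpace.val C.sumMap (C.incl₀ x) = C.ι₀ x := by
  refine (ImageSpace.val_mk C.sumMap (WithLp.toLp 1 (x, 0))).trans ?_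
  simp [sumMap]

theorem val_incl₁ (x : X₁) : ImageSpace.val C.sumMap (C.incl₁ x) = C.ι₁ x := by
  refine (ImageSpace.val_mk C.sumMap (WithLp.toLp 1 (0, x))).trans ?_
  simp [sumMap]

theorem norm_incl₀_le (x : X₀) : ‖C.incl₀ x‖ ≤ ‖x‖ := by
  refine (ImageSpace.norm_mk_le _ _).trans ?_
  simp

theorem norm_incl₁_le (x : X₁) : ‖C.incl₁ x‖ ≤ ‖x‖ := by
  refine (ImageSpace.norm_mk_le _ _).trans ?_
  simp

/-! ### The complex method -/

/-- The functions `f : {1 ≤ |z| ≤ e} → X₀ + X₁`, continuous, analytic on the open annulus, which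
are `X₀`-valued and `X₀`-continuous on `|z| = 1` and `X₁`-valued and `X₁`-continuous on `|z| = e`.
Such an `f` is recorded with its restrictions to the two circles as an `X₀`-valued and
an `X₁`-valued function, which it determines because the inclusions are injective. -/
def calFSubmodule : Submodule ℂ (C(closedAnnulus, C.SumSpace) ×
    C(Metric.sphere (0 : ℂ) 1, X₀) × C(Metric.sphere (0 : ℂ) (Real.exp 1), X₁)) where
  carrier := {p | IsAnalyticInside p.1 ∧ (∀ z, p.1 (innerPt z) = C.incl₀ (p.2.1 z)) ∧
    ∀ z, p.1 (outerPt z) = C.incl₁ (p.2.2 z)}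
  zero_mem' := by
    refine ⟨?_, by simp, by simp⟩
    have : Function.extend Subtype.val (⇑(0 : C(closedAnnulus, C.SumSpace))) 0 =
        (0 : ℂ → C.SumSpace) := Function.extend_zero _
    simp only [IsAnalyticInside, Prod.fst_zero, this]
    exact differentiableOn_const _
  add_mem' := by
    rintro p q ⟨hp, hp₀, hp₁⟩ ⟨hq, hq₀, hq₁⟩
    refine ⟨?_, by simp [hp₀, hq₀], by simp [hp₁, hq₁]⟩
    have := hp.add hq
    rwa [← Function.extend_add, add_zero] at this
  smul_mem' := by
    rintro c p ⟨hp, hp₀, hp₁⟩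
    refine ⟨?_, by simp [hp₀], by simp [hp₁]⟩
    have := hp.const_smul c
    rwa [← Function.extend_smul, smul_zero] at this

/-- The space `𝓕(X₀, X₁)`. -/
def CalF : Type _ := ↥C.calFSubmodule

namespace CalF

instance : AddCommGroup C.CalF := inferInstanceAs (AddCommGroup ↥C.calFSubmodule)

instance : Module ℂ C.CalF := inferInstanceAs (Module ℂ ↥C.calFSubmodule)

/-- The underlying `X₀ + X₁`-valued function on the closed annulus. -/
def fn : C.CalF →ₗ[ℂ] C(closedAnnulus, C.SumSpace) :=
  LinearMap.fst ℂ _ _ ∘ₗ C.calFSubmodule.subtype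

/-- The pair consisting of the `X₀`-valued function on `|z| = 1` and the `X₁`-valued function
on `|z| = e`. -/
def bdry : C.CalF →ₗ[ℂ]
    C(Metric.sphere (0 : ℂ) 1, X₀) × C(Metric.sphere (0 : ℂ) (Real.exp 1), X₁) :=
  LinearMap.snd ℂ _ _ ∘ₗ C.calFSubmodule.subtype

theorem norm_fn_le (f : C.CalF) (z : closedAnnulus) : ‖fn C f z‖ ≤ ‖bdry C f‖ := by
  obtain ⟨hf, h₀, h₁⟩ := f.2
  refine hf.norm_le (fun w => ?_) (fun w => ?_) z
  · rw [h₀]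
    exact (C.norm_incl₀_le _).trans
      ((ContinuousMap.norm_coe_le_norm _ _).trans (norm_fst_le (bdry C f)))
  · rw [h₁]
    exact (C.norm_incl₁_le _).trans
      ((ContinuousMap.norm_coe_le_norm _ _).trans (norm_snd_le (bdry C f)))

theorem bdry_injective : Function.Injective (bdry C) := by
  refine (injective_iff_map_eq_zero _).2 fun f hf => Subtype.ext (Prod.ext ?_ hf)
  refine ContinuousMap.ext fun z => ?_
  have := norm_fn_le C f z
  rw [hf, norm_zero] at this
  exact norm_le_zero_iff.1 this

/-- `‖f‖ = max (max_{|z| = 1} ‖f z‖_{X₀}) (max_{|z| = e} ‖f z‖_{X₁})`. -/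
instance : NormedAddCommGroup C.CalF :=
  NormedAddCommGroup.induced C.CalF _ (bdry C) (bdry_injective C)

instance : NormedSpace ℂ C.CalF := NormedSpace.induced ℂ C.CalF _ (bdry C)

end CalF

/-- The evaluation `f ↦ f(e ^ θ)`. -/
def evalAt (θ : Set.Icc (0 : ℝ) 1) : C.CalF →L[ℂ] C.SumSpace :=
  LinearMap.mkContinuous
    { toFun := fun f => CalF.fn C f (expPt θ)
      map_add' := fun f g => by simp
      map_smul' := fun c f => by simp } 1
    (fun f => (CalF.norm_fn_le C f (expPt θ)).trans (one_mul ‖f‖).ge)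

/-- The complex interpolation space `[X₀, X₁]_θ = {f(e ^ θ) : f ∈ 𝓕} ⊆ X₀ + X₁`, with the norm
`‖x‖ = inf {‖f‖ : f ∈ 𝓕, f(e ^ θ) = x}`. -/
abbrev Interp (θ : Set.Icc (0 : ℝ) 1) : Type _ := ImageSpace (C.evalAt θ)

/-- The inclusion `[X₀, X₁]_θ ⊆ X₀ + X₁`. -/
abbrev interpVal (θ : Set.Icc (0 : ℝ) 1) : C.Interp θ →ₗ[ℂ] C.SumSpace :=
  ImageSpace.val (C.evalAt θ)

end BanachCouple

/-! ### UMD spaces -/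

/-- `X` is a UMD space, in the sense that the `X`-valued Riesz projection
`∑ f̂(k) z^k ↦ ∑_{k ≥ 0} f̂(k) z^k` is a bounded operator on `L²(𝕋, X)`. -/
def IsUMD (X : Type*) [NormedAddCommGroup X] [NormedSpace ℂ X] : Prop :=
  ∃ R : MeasureTheory.Lp X 2 (AddCircle.haarAddCircle (T := (1 : ℝ))) →L[ℂ]
      MeasureTheory.Lp X 2 (AddCircle.haarAddCircle (T := (1 : ℝ))),
    ∀ (f : MeasureTheory.Lp X 2 (AddCircle.haarAddCircle (T := (1 : ℝ)))) (k : ℤ),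
      fourierCoeff (R f) k = if 0 ≤ k then fourierCoeff f k else 0

end

/-!
# Compactness of interpolated operators, when the first space of the domain is UMD

Let `f` lie in the unit ball of `𝓕(X)`. Averaging `f` over rotations with a positive trigonometric
kernel keeps only finitely many Laurent coefficients, and these lie in bounded subsets of
`X₀ ∩ X₁`; so `f ↦ T ((averaged f) (e ^ θ))` is a compact operator from `𝓕(X)` to `[Y₀, Y₁]_θ`
(`isCompactOperator_averageOp`). The point is that these operators converge in norm to
`f ↦ T (f (e ^ θ))` (`exists_norm_mapValue_sub_averageOp_le`), which is then compact, and so is the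
map it induces on the quotient `[X₀, X₁]_θ` of `𝓕(X)`. By density it is enough to consider Laurent
polynomials `f` with coefficients in `X₀ ∩ X₁` (`tendsto_laurent_coeff`).

To bound the value at `e ^ θ` of some `h ∈ 𝓕(Y)`, it is enough that `h` is bounded in `Y₁` on
`|z| = e` and that the *mean* of `‖h‖` in `Y₀` over `|z| = 1` is small (`exists_norm_value_le`): one
divides `h` by a scalar analytic function, bounded below on the annulus, whose modulus majorizes
`‖h‖` on `|z| = 1` (`exists_majorant`).

Let `g` be the difference of `f` and its average. It is bounded on both circles, and `T g` is split
by frequencies on `|z| = 1`.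

* The frequencies in `[-N, N)` are negligible because the kernel has Fourier coefficients close
  to `1` there.
* For the frequencies `≥ N`, the bound on `|z| = e` makes the coefficients exponentially small in
  `X₁`. The UMD property bounds this part of `g` in `L²(X₀)`, so by Ehrling's lemma for the compact
  operator `T : X₀ → Y₀` its image is small in `L¹(Y₀)` (`exists_innerMean_filter_ge_le`).
* For the frequencies `< -N`, the values of `T g` lie in a compact set. A finite net `T x j` with
  `x j ∈ X₀ ∩ X₁` and a partition of unity give a function `u = ∑ φ j • x j` such that `T (g - u)`
  is small on `|z| = 1`. The projection of `g - u` to the frequencies `< -N` is bounded in `L²(X₀)`,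
  again by the UMD property; up to a small error the norm of its image is computed by finitely many
  functionals, and scalar frequency projections are contractions of `L²`, so the image stays small
  (`exists_correction`). The corresponding part of `u` has coefficients bounded in `X₀ ∩ X₁` and
  frequencies `< -N` only, so it is negligible both on `|z| = e` and at `e ^ θ`.
-/

open MeasureTheory AddCircle Filter Topology

noncomputable section

local notation "𝕋" => AddCircle (1 : ℝ)
local notation "haar𝕋" => AddCircle.haarAddCircle (T := (1 : ℝ))

/-! ### Vector-valued trigonometric polynomials -/

section Trig

theorem integrable_continuousMap {X : Type*} [NormedAddCommGroup X] (f : C(𝕋, X)) :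
    Integrable f haar𝕋 :=
  f.continuous.integrable_of_hasCompactSupport (HasCompactSupport.of_compactSpace _)

variable {X Y : Type*} [NormedAddCommGroup X] [NormedSpace ℂ X]
  [NormedAddCommGroup Y] [NormedSpace ℂ Y]

/-- The trigonometric polynomial `∑ a k • e^{2πikt}` with finitely supported coefficients in `X`,
as a continuous function on the circle. -/
def trig : (ℤ →₀ X) →ₗ[ℂ] C(𝕋, X) :=
  Finsupp.lsum ℂ fun k =>
    { toFun := fun x => ⟨fun t => fourier k t • x, by fun_prop⟩
      map_add' := fun x y => by ext t; simp
      map_smul' := fun c x => by ext t; simp [smul_comm c] }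

theorem trig_apply (a : ℤ →₀ X) (t : 𝕋) : trig a t = a.sum fun k x => fourier k t • x := by
  simp [trig, Finsupp.sum, ContinuousMap.sum_apply]

@[simp] theorem trig_single_apply (k : ℤ) (x : X) (t : 𝕋) :
    trig (Finsupp.single k x) t = fourier k t • x := by
  rw [trig_apply, Finsupp.sum_single_index (by simp)]

theorem norm_fourier_apply (k : ℤ) (t : 𝕋) : ‖fourier k t‖ = 1 := by
  rw [fourier_apply]; exact Circle.norm_coe _

theorem norm_trig_apply_le (a : ℤ →₀ X) (t : 𝕋) : ‖trig a t‖ ≤ a.sum fun _ x => ‖x‖ := by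
  rw [trig_apply]
  refine (norm_sum_le _ _).trans (Finset.sum_le_sum fun k _ => ?_)
  rw [norm_smul, norm_fourier_apply, one_mul]

theorem trig_mapRange (L : X →L[ℂ] Y) (a : ℤ →₀ X) (t : 𝕋) :
    trig (Finsupp.mapRange.linearMap L.toLinearMap a) t = L (trig a t) := by
  induction a using Finsupp.induction_linear with
  | zero => simp
  | add a b ha hb => simp only [map_add, ContinuousMap.add_apply, ha, hb]
  | single k x => simp

theorem norm_fourierCoeff_le_integral (f : 𝕋 → X) (k : ℤ) :
    ‖fourierCoeff f k‖ ≤ ∫ t, ‖f t‖ ∂haar𝕋 := by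
  refine (norm_integral_le_integral_norm _).trans (le_of_eq ?_)
  simp only [norm_smul, norm_fourier_apply, one_mul]

theorem norm_fourierCoeff_le {f : C(𝕋, X)} {M : ℝ} (h : ∀ t, ‖f t‖ ≤ M) (k : ℤ) :
    ‖fourierCoeff f k‖ ≤ M := by
  refine (norm_fourierCoeff_le_integral f k).trans ?_
  refine (integral_mono (integrable_continuousMap f).norm (integrable_const M) h).trans ?_
  simp

variable [CompleteSpace X] [CompleteSpace Y]

theorem fourierCoeff_trig (a : ℤ →₀ X) (k : ℤ) : fourierCoeff (trig a) k = a k := by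
  induction a using Finsupp.induction_linear with
  | zero => simp [fourierCoeff]
  | add a b ha hb =>
    rw [map_add, ContinuousMap.coe_add, fourierCoeff.add (integrable_continuousMap _)
      (integrable_continuousMap _), Pi.add_apply, ha, hb, Finsupp.add_apply]
  | single j x =>
    have h := congrFun (fourierCoeff_fourier (T := (1 : ℝ)) j) k
    simp only [fourierCoeff, trig_single_apply, smul_smul] at h ⊢
    rw [integral_smul_const]
    simp only [smul_eq_mul] at h
    rw [h, Finsupp.single_apply, Pi.single_apply]
    by_cases hjk : j = k
    · rw [if_pos hjk, if_pos hjk.symm, one_smul]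
    · rw [if_neg hjk, if_neg (Ne.symm hjk), zero_smul]

theorem norm_coeff_le_of_trig {a : ℤ →₀ X} {M : ℝ} (h : ∀ t, ‖trig a t‖ ≤ M) (k : ℤ) :
    ‖a k‖ ≤ M := by
  rw [← fourierCoeff_trig a k]
  exact norm_fourierCoeff_le h k

theorem ContinuousLinearMap.fourierCoeff_comp (L : X →L[ℂ] Y) {f : 𝕋 → X}
    (hf : Integrable f haar𝕋) (k : ℤ) :
    fourierCoeff (fun t => L (f t)) k = L (fourierCoeff f k) := by
  rw [fourierCoeff, fourierCoeff, ← L.integral_comp_comm (hf.fourier_smul (-k))]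
  simp

end Trig

/-! ### An approximate identity of trigonometric polynomials -/

section Kernel

/-- The function `(1 + cos 2πt) / 2`, whose normalized powers are an approximate identity. -/
def bump (t : 𝕋) : ℝ := (1 + (fourier 1 t).re) / 2

theorem continuous_bump : Continuous bump := by unfold bump; fun_prop

theorem bump_nonneg (t : 𝕋) : 0 ≤ bump t := by
  have := (abs_le.1 (Complex.abs_re_le_norm (fourier 1 t))).1
  rw [norm_fourier_apply] at this
  unfold bump; linarith

theorem bump_zero : bump 0 = 1 := by
  simp only [bump, fourier_eval_zero, Complex.one_re]; norm_num

theorem bump_lt {t : 𝕋} (ht : t ≠ 0) : bump t < bump 0 := by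
  rw [bump_zero]
  have h1 := Complex.re_le_norm (fourier 1 t)
  rw [norm_fourier_apply] at h1
  have h2 : (fourier 1 t).re ≠ 1 := by
    intro h
    have hn := norm_fourier_apply 1 t
    have him : (fourier 1 t).im = 0 := by
      have := Complex.sq_norm (fourier 1 t)
      rw [hn, Complex.normSq_apply, h] at this
      nlinarith
    have h3 : fourier 1 t = (1 : ℂ) := Complex.ext (by simpa using h) (by simpa using him)
    rw [fourier_one] at h3
    apply ht
    apply AddCircle.injective_toCircle (T := (1 : ℝ)) one_ne_zero
    rw [AddCircle.toCircle_zero]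
    exact Subtype.ext h3
  have := lt_of_le_of_ne h1 h2
  unfold bump; linarith

theorem bump_eq (t : 𝕋) : ((bump t : ℝ) : ℂ) = (1 + (fourier 1 t + fourier (-1) t) / 2) / 2 := by
  rw [fourier_neg, Complex.add_conj, bump]
  push_cast; ring

/-- The normalizing constant of the `n`-th power of `bump`. -/
def bumpMass (n : ℕ) : ℝ := ∫ t, bump t ^ n ∂haar𝕋

theorem integrable_bump_pow (n : ℕ) : Integrable (fun t => bump t ^ n) haar𝕋 :=
  (continuous_bump.pow n).integrable_of_hasCompactSupport (HasCompactSupport.of_compactSpace _)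

theorem bumpMass_pos (n : ℕ) : 0 < bumpMass n :=
  (continuous_bump.pow n).integral_pos_of_hasCompactSupport_nonneg_nonzero
    (HasCompactSupport.of_compactSpace _) (fun t => pow_nonneg (bump_nonneg t) n)
    (x := 0) (by simp [bump_zero])

theorem exists_trig_kernel (n : ℕ) : ∃ κ : ℤ →₀ ℂ, ∀ t : 𝕋,
    (((bumpMass n)⁻¹ * bump t ^ n : ℝ) : ℂ) = trig κ t := by
  let f : C(𝕋, ℂ) := ((bumpMass n : ℂ)⁻¹) •
    (((1 / 2 : ℂ) • (1 + (1 / 2 : ℂ) • (fourier 1 + fourier (-1)))) ^ n)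
  have hf : f ∈ (fourierSubalgebra (T := (1 : ℝ))).toSubalgebra := by
    have h : ∀ k, fourier k ∈ (fourierSubalgebra (T := (1 : ℝ))).toSubalgebra := fun k =>
      Algebra.subset_adjoin ⟨k, rfl⟩
    refine Subalgebra.smul_mem _ (Subalgebra.pow_mem _ (Subalgebra.smul_mem _ (Subalgebra.add_mem _
      (Subalgebra.one_mem _) (Subalgebra.smul_mem _ (Subalgebra.add_mem _ (h _) (h _)) _)) _) _) _
  rw [← Subalgebra.mem_toSubmodule, fourierSubalgebra_coe,
    Finsupp.mem_span_range_iff_exists_finsupp] at hf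
  obtain ⟨κ, hκ⟩ := hf
  refine ⟨κ, fun t => ?_⟩
  have h := congrArg (fun g : C(𝕋, ℂ) => g t) hκ
  have h2 : trig κ t = (κ.sum fun i a => a • fourier i) t := by
    rw [trig_apply, Finsupp.sum, Finsupp.sum, ContinuousMap.sum_apply]
    exact Finset.sum_congr rfl fun k _ => by simp [mul_comm]
  rw [h2, h]
  simp only [f, ContinuousMap.smul_apply, ContinuousMap.pow_apply, ContinuousMap.add_apply,
    ContinuousMap.one_apply, smul_eq_mul]
  push_cast
  rw [bump_eq]
  ring

/-- The Fourier coefficients of the kernel `bump ^ n / ∫ bump ^ n`. -/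
def kernelCoeff (n : ℕ) : ℤ →₀ ℂ := (exists_trig_kernel n).choose

theorem trig_kernelCoeff (n : ℕ) (t : 𝕋) :
    trig (kernelCoeff n) t = (((bumpMass n)⁻¹ * bump t ^ n : ℝ) : ℂ) :=
  ((exists_trig_kernel n).choose_spec t).symm

/-- The translates `t ↦ f (t - s)` of a continuous function on the circle. -/
def shifts {X : Type*} [NormedAddCommGroup X] (f : C(𝕋, X)) : C(𝕋, C(𝕋, X)) :=
  ContinuousMap.curry ⟨fun p : 𝕋 × 𝕋 => f (p.2 - p.1), by fun_prop⟩

@[simp] theorem shifts_apply {X : Type*} [NormedAddCommGroup X] (f : C(𝕋, X)) (s t : 𝕋) :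
    shifts f s t = f (t - s) := rfl

variable {X : Type*} [NormedAddCommGroup X] [NormedSpace ℂ X]

/-- The finitely supported sequence `κ k • a k`. -/
def coeffMul (κ : ℤ →₀ ℂ) (a : ℤ → X) : ℤ →₀ X :=
  Finsupp.onFinset κ.support (fun k => κ k • a k) fun k hk => by
    rw [Finsupp.mem_support_iff]; rintro h; simp [h] at hk

@[simp] theorem coeffMul_apply (κ : ℤ →₀ ℂ) (a : ℤ → X) (k : ℤ) : coeffMul κ a k = κ k • a k := rfl

theorem coeffMul_support (κ : ℤ →₀ ℂ) (a : ℤ → X) : (coeffMul κ a).support ⊆ κ.support :=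
  Finsupp.support_onFinset_subset

theorem integrable_smul_shifts (n : ℕ) (f : C(𝕋, X)) :
    Integrable (fun s => bump s ^ n • shifts f s) haar𝕋 :=
  ((continuous_bump.pow n).smul (shifts f).continuous).integrable_of_hasCompactSupport
    (HasCompactSupport.of_compactSpace _)

theorem integral_fourier_smul_sub (k : ℤ) (f : 𝕋 → X) (t : 𝕋) :
    ∫ s, fourier k s • f (t - s) ∂haar𝕋 = fourier k t • fourierCoeff f k := by
  rw [fourierCoeff, ← integral_smul, ← integral_sub_left_eq_self _ haar𝕋 t]
  refine integral_congr_ae (Eventually.of_forall fun s => ?_)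
  simp only [sub_sub_cancel, smul_smul]
  congr 1
  rw [fourier_apply, fourier_apply, fourier_apply, smul_sub, neg_smul, sub_eq_add_neg,
    toCircle_add, Circle.coe_mul]

variable [CompleteSpace X]

/-- The convolution of `f` with the kernel `bump ^ n / ∫ bump ^ n`. -/
def kernelMean (n : ℕ) (f : C(𝕋, X)) : C(𝕋, X) :=
  (bumpMass n)⁻¹ • ∫ s, bump s ^ n • shifts f s ∂haar𝕋

theorem tendsto_kernelMean (f : C(𝕋, X)) : Tendsto (fun n => kernelMean n f) atTop (𝓝 f) := by
  have h := tendsto_setIntegral_pow_smul_of_unique_maximum_of_isCompact_of_continuousOn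
    (μ := haar𝕋) (g := shifts f) (x₀ := (0 : 𝕋)) isCompact_univ continuous_bump.continuousOn
    (fun y _ hy => bump_lt hy) (fun x _ => bump_nonneg x) (by simp [bump_zero]) (by simp)
    (shifts f).continuous.continuousOn
  have h0 : shifts f 0 = f := by ext t; simp
  rw [h0] at h
  simp only [Measure.restrict_univ] at h
  exact h

theorem kernelMean_apply (n : ℕ) (f : C(𝕋, X)) (t : 𝕋) :
    kernelMean n f t = (bumpMass n)⁻¹ • ∫ s, bump s ^ n • f (t - s) ∂haar𝕋 := by
  rw [kernelMean, ContinuousMap.smul_apply,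
    ContinuousMap.integral_apply (integrable_smul_shifts n f)]
  rfl

theorem norm_kernelMean_apply_le {n : ℕ} {f : C(𝕋, X)} {M : ℝ} (h : ∀ t, ‖f t‖ ≤ M) (t : 𝕋) :
    ‖kernelMean n f t‖ ≤ M := by
  rw [kernelMean_apply, norm_smul, norm_inv, Real.norm_of_nonneg (bumpMass_pos n).le,
    inv_mul_le_iff₀ (bumpMass_pos n)]
  calc ‖∫ s, bump s ^ n • f (t - s) ∂haar𝕋‖ ≤ ∫ s, bump s ^ n * M ∂haar𝕋 := by
        refine norm_integral_le_of_norm_le ((integrable_bump_pow n).mul_const M)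
          (Eventually.of_forall fun s => ?_)
        rw [norm_smul, Real.norm_of_nonneg (pow_nonneg (bump_nonneg s) n)]
        exact mul_le_mul_of_nonneg_left (h _) (pow_nonneg (bump_nonneg s) n)
    _ = bumpMass n * M := by rw [integral_mul_const, bumpMass]

theorem kernelMean_eq_trig (n : ℕ) (f : C(𝕋, X)) :
    kernelMean n f = trig (coeffMul (kernelCoeff n) (fourierCoeff f)) := by
  ext t
  have h1 : kernelMean n f t = ∫ s, trig (kernelCoeff n) s • f (t - s) ∂haar𝕋 := by
    rw [kernelMean_apply, ← integral_smul]
    refine integral_congr_ae (Eventually.of_forall fun s => ?_)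
    simp only [trig_kernelCoeff, smul_smul]
    exact (RCLike.real_smul_eq_coe_smul (K := ℂ) _ _)
  have h2 : (fun s => trig (kernelCoeff n) s • f (t - s)) = fun s =>
      ∑ k ∈ (kernelCoeff n).support, kernelCoeff n k • fourier k s • f (t - s) := by
    ext s
    rw [trig_apply, Finsupp.sum, Finset.sum_smul]
    exact Finset.sum_congr rfl fun k _ => by rw [smul_eq_mul, mul_comm, smul_smul]
  rw [h1, h2, integral_finsetSum]
  · rw [trig_apply, Finsupp.sum_of_support_subset (s := (kernelCoeff n).support) _
      (coeffMul_support _ _) _ (fun _ _ => smul_zero _)]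
    refine Finset.sum_congr rfl fun k _ => ?_
    rw [integral_smul, integral_fourier_smul_sub, coeffMul_apply, smul_comm]
  · intro k _
    have : Continuous fun s => kernelCoeff n k • fourier k s • f (t - s) := by fun_prop
    exact this.integrable_of_hasCompactSupport (HasCompactSupport.of_compactSpace _)

theorem kernelMean_trig (n : ℕ) (a : ℤ →₀ X) :
    kernelMean n (trig a) = trig (coeffMul (kernelCoeff n) a) := by
  rw [kernelMean_eq_trig]
  congr 1
  ext k
  simp [fourierCoeff_trig]

theorem tendsto_kernelCoeff (k : ℤ) : Tendsto (fun n => kernelCoeff n k) atTop (𝓝 1) := by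
  have h := tendsto_kernelMean (X := ℂ) (fourier k)
  have h2 : ∀ n, kernelMean n (fourier k) 0 = kernelCoeff n k := by
    intro n
    have : (fourier k : C(𝕋, ℂ)) = trig (Finsupp.single k 1) := by ext t; simp
    have h3 : coeffMul (kernelCoeff n) (Finsupp.single k (1 : ℂ)) =
        Finsupp.single k (kernelCoeff n k) := by
      ext j
      rw [coeffMul_apply, Finsupp.single_apply, Finsupp.single_apply]
      split_ifs with hj <;> simp [hj]
    rw [this, kernelMean_trig, h3, trig_single_apply]
    simp
  have h4 := ((ContinuousMap.evalCLM ℂ (0 : 𝕋) : C(𝕋, ℂ) →L[ℂ] ℂ).continuous.tendsto _).comp h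
  simp only [Function.comp_def, ContinuousMap.evalCLM_apply, h2, fourier_eval_zero] at h4
  exact h4

end Kernel

/-! ### Truncation of trigonometric polynomials in `L²` -/

section LTwo

variable {X Y : Type*} [NormedAddCommGroup X] [NormedSpace ℂ X]
  [NormedAddCommGroup Y] [NormedSpace ℂ Y]

/-- The norm of a continuous function on the circle in `L²`. -/
def normLTwo (f : C(𝕋, X)) : ℝ := ‖ContinuousMap.toLp (E := X) 2 haar𝕋 ℂ f‖

theorem normLTwo_nonneg (f : C(𝕋, X)) : 0 ≤ normLTwo f := norm_nonneg _

theorem normLTwo_sub_le (f g : C(𝕋, X)) : normLTwo (f - g) ≤ normLTwo f + normLTwo g := by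
  rw [normLTwo, map_sub]; exact norm_sub_le _ _

theorem normLTwo_mono {f : C(𝕋, X)} {g : C(𝕋, Y)} (h : ∀ t, ‖f t‖ ≤ ‖g t‖) :
    normLTwo f ≤ normLTwo g := by
  refine Lp.norm_le_norm_of_ae_le ?_
  filter_upwards [ContinuousMap.coeFn_toLp (𝕜 := ℂ) (p := 2) haar𝕋 f,
    ContinuousMap.coeFn_toLp (𝕜 := ℂ) (p := 2) haar𝕋 g] with t h1 h2
  rw [h1, h2]; exact h t

theorem normLTwo_le {f : C(𝕋, X)} {M : ℝ} (h : ∀ t, ‖f t‖ ≤ M) : normLTwo f ≤ M := by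
  have hM : 0 ≤ M := (norm_nonneg _).trans (h 0)
  have := Lp.norm_le_of_ae_bound (f := ContinuousMap.toLp (E := X) 2 haar𝕋 ℂ f) hM (by
    filter_upwards [ContinuousMap.coeFn_toLp (𝕜 := ℂ) (p := 2) haar𝕋 f] with t h1
    rw [h1]; exact h t)
  simpa [normLTwo, measureUnivNNReal] using this

theorem integral_norm_le_normLTwo (f : C(𝕋, X)) : ∫ t, ‖f t‖ ∂haar𝕋 ≤ normLTwo f := by
  have hf := (integrable_continuousMap f).aestronglyMeasurable
  have hae := ContinuousMap.coeFn_toLp (𝕜 := ℂ) (p := 2) haar𝕋 f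
  have h1 : eLpNorm f 1 haar𝕋 ≤ eLpNorm f 2 haar𝕋 :=
    eLpNorm_le_eLpNorm_of_exponent_le (by norm_num) hf
  rw [normLTwo, Lp.norm_def, eLpNorm_congr_ae hae, integral_norm_eq_lintegral_enorm hf,
    ← eLpNorm_one_eq_lintegral_enorm]
  refine ENNReal.toReal_mono ?_ h1
  rw [← eLpNorm_congr_ae hae]
  exact Lp.eLpNorm_ne_top _

theorem fourierCoeff_coe_toLp (f : C(𝕋, X)) (k : ℤ) :
    fourierCoeff (ContinuousMap.toLp (E := X) 2 haar𝕋 ℂ f) k = fourierCoeff f k :=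
  congrFun (fourierCoeff_congr_ae (ContinuousMap.coeFn_toLp (𝕜 := ℂ) (p := 2) haar𝕋 f)) k

theorem integrable_of_lp_two {X : Type*} [NormedAddCommGroup X] (f : Lp X 2 haar𝕋) :
    Integrable f haar𝕋 :=
  (Lp.memLp f).integrable (by norm_num)

theorem trig_equivMapDomain (a : ℤ →₀ X) (N : ℤ) (t : 𝕋) :
    trig (a.equivMapDomain (Equiv.addRight N)) t = fourier N t • trig a t := by
  rw [trig_apply, trig_apply, Finsupp.smul_sum, Finsupp.equivMapDomain_eq_mapDomain,
    Finsupp.sum_mapDomain_index_inj (Equiv.addRight N).injective]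
  refine Finsupp.sum_congr fun k _ => ?_
  rw [Equiv.coe_addRight, fourier_add, smul_smul, mul_comm]

theorem trig_filter_lt (N : ℤ) (a : ℤ →₀ X) :
    trig (a.filter (· < N)) = trig a - trig (a.filter (N ≤ ·)) := by
  rw [← map_sub]
  congr 1
  ext k
  simp only [Finsupp.filter_apply, Finsupp.sub_apply]
  split_ifs with h1 h2 h2
  · omega
  · simp
  · simp
  · omega

variable [CompleteSpace X]

/-- The Fourier coefficients of a vector-valued square-integrable function determine it: compose
with functionals to reduce to the scalar case. -/
theorem eq_zero_of_fourierCoeff_eq_zero (f : Lp X 2 haar𝕋) (h : ∀ k, fourierCoeff f k = 0) :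
    f = 0 := by
  rw [Lp.eq_zero_iff_ae_eq_zero]
  obtain ⟨s, hs, hfs⟩ := (Lp.aestronglyMeasurable f).isSeparable_ae_range
  refine ae_eq_zero_of_forall_dual_of_isSeparable ℂ hs (fun c => ?_) hfs
  have hg : (fun t => c (f t)) =ᵐ[haar𝕋] c.compLp f := by
    filter_upwards [c.coeFn_compLp f] with t ht using ht.symm
  have hzero : c.compLp f = 0 := by
    have hc : ∀ k, fourierCoeff (c.compLp f) k = 0 := fun k => by
      rw [← congrFun (fourierCoeff_congr_ae hg) k,
        ContinuousLinearMap.fourierCoeff_comp c (integrable_of_lp_two f) k, h k, map_zero]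
    have hsum := hasSum_fourier_series_L2 (c.compLp f)
    simp only [hc, zero_smul] at hsum
    exact hsum.unique hasSum_zero
  rw [hzero] at hg
  exact hg.trans (Lp.coeFn_zero _ _ _)

theorem eq_of_fourierCoeff_eq {f g : Lp X 2 haar𝕋} (h : ∀ k, fourierCoeff f k = fourierCoeff g k) :
    f = g := by
  rw [← sub_eq_zero]
  refine eq_zero_of_fourierCoeff_eq_zero _ fun k => ?_
  have h1 := fourierCoeff_congr_ae (Lp.coeFn_sub f g)
  have h2 : (f - g : 𝕋 → X) = f + (-1 : ℂ) • (g : 𝕋 → X) := by ext t; simp [sub_eq_add_neg]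
  rw [congrFun h1 k, h2, fourierCoeff.add (integrable_of_lp_two f)
    ((integrable_of_lp_two g).smul _), Pi.add_apply, fourierCoeff.const_smul, h k]
  simp

/-- In a UMD space, truncations of trigonometric polynomials to the frequencies `≥ N` are bounded
in `L²` uniformly in `N`: multiplication by a character moves the cut to `0`. -/
theorem IsUMD.exists_bound (hX : IsUMD X) : ∃ C : ℝ, 0 ≤ C ∧ ∀ (N : ℤ) (a : ℤ →₀ X),
    normLTwo (trig (a.filter (N ≤ ·))) ≤ C * normLTwo (trig a) := by
  obtain ⟨R, hR⟩ := hX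
  have h0 : ∀ a : ℤ →₀ X, normLTwo (trig (a.filter (0 ≤ ·))) ≤ ‖R‖ * normLTwo (trig a) := by
    intro a
    have : R (ContinuousMap.toLp (E := X) 2 haar𝕋 ℂ (trig a)) =
        ContinuousMap.toLp (E := X) 2 haar𝕋 ℂ (trig (a.filter (0 ≤ ·))) := by
      refine eq_of_fourierCoeff_eq fun k => ?_
      rw [hR, fourierCoeff_coe_toLp, fourierCoeff_coe_toLp, fourierCoeff_trig, fourierCoeff_trig,
        Finsupp.filter_apply]
    rw [normLTwo, ← this]
    exact R.le_opNorm _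
  refine ⟨‖R‖, norm_nonneg _, fun N a => ?_⟩
  have h1 := h0 (a.equivMapDomain (Equiv.addRight (-N)))
  have h2 : a.filter (N ≤ ·) = ((a.equivMapDomain (Equiv.addRight (-N))).filter
      (0 ≤ ·)).equivMapDomain (Equiv.addRight N) := by
    ext k
    simp [Finsupp.filter_apply, Finsupp.equivMapDomain_apply]
  refine le_trans (normLTwo_mono fun t => ?_) (h1.trans ?_)
  · rw [h2, trig_equivMapDomain, norm_smul, norm_fourier_apply, one_mul]
  · refine mul_le_mul_of_nonneg_left (normLTwo_mono fun t => ?_) (norm_nonneg _)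
    rw [trig_equivMapDomain, norm_smul, norm_fourier_apply, one_mul]

theorem normLTwo_trig_sq (a : ℤ →₀ ℂ) : normLTwo (trig a) ^ 2 = ∑ k ∈ a.support, ‖a k‖ ^ 2 := by
  let f := ContinuousMap.toLp (E := ℂ) 2 haar𝕋 ℂ (trig a)
  have h1 : HasSum (fun i => ‖fourierBasis.repr f i‖ ^ 2) (‖fourierBasis.repr f‖ ^ 2) := by
    apply_mod_cast lp.hasSum_norm ?_ (fourierBasis.repr f)
    simp
  simp only [fourierBasis_repr, LinearIsometryEquiv.norm_map, f, fourierCoeff_coe_toLp,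
    fourierCoeff_trig] at h1
  exact h1.unique <| hasSum_sum_of_ne_finset_zero fun k hk => by
    simp [Finsupp.notMem_support_iff.1 hk]

theorem normLTwo_filter_le (a : ℤ →₀ ℂ) (p : ℤ → Prop) [DecidablePred p] :
    normLTwo (trig (a.filter p)) ≤ normLTwo (trig a) := by
  refine le_of_sq_le_sq ?_ (normLTwo_nonneg _)
  rw [normLTwo_trig_sq, normLTwo_trig_sq, Finsupp.support_filter]
  refine (Finset.sum_congr rfl fun k hk => ?_).trans_le
    (Finset.sum_le_sum_of_subset_of_nonneg (Finset.filter_subset _ _) fun k _ _ => by positivity)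
  rw [Finsupp.filter_apply_pos _ _ (Finset.mem_filter.1 hk).2]

end LTwo

/-! ### Inequalities for compact operators -/

section Compact

variable {V W Z : Type*} [NormedAddCommGroup V] [NormedSpace ℂ V]
  [NormedAddCommGroup W] [NormedSpace ℂ W] [NormedAddCommGroup Z] [NormedSpace ℂ Z]

theorem exists_norm_le_one_eq_smul (x : V) : ∃ x' : V, ‖x'‖ ≤ 1 ∧ x = (‖x‖ : ℂ) • x' := by
  rcases eq_or_ne x 0 with rfl | hx
  · exact ⟨0, by simp, by simp⟩
  · have hn : (‖x‖ : ℂ) ≠ 0 := by simpa using hx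
    refine ⟨(‖x‖ : ℂ)⁻¹ • x, ?_, ?_⟩
    · rw [norm_smul, norm_inv, Complex.norm_real, norm_norm, inv_mul_cancel₀ (by simpa using hx)]
    · rw [smul_smul, mul_inv_cancel₀ hn, one_smul]

/-- Ehrling's lemma: an injective map does not make the values of a compact operator much
smaller. -/
theorem IsCompactOperator.exists_norm_le_add_norm_comp {S : V →L[ℂ] W} (hS : IsCompactOperator S)
    {q : W →L[ℂ] Z} (hq : Function.Injective q) {δ : ℝ} (hδ : 0 < δ) :
    ∃ C : ℝ, 0 ≤ C ∧ ∀ x, ‖S x‖ ≤ δ * ‖x‖ + C * ‖q (S x)‖ := by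
  have hK : IsCompact (closure (S '' Metric.closedBall 0 1) ∩ {y | δ ≤ ‖y‖}) :=
    (IsCompactOperator.isCompact_closure_image_closedBall (f := S.toLinearMap) hS 1).inter_right
      (isClosed_le continuous_const continuous_norm)
  have key : ∃ C : ℝ, 0 ≤ C ∧ ∀ x, ‖x‖ ≤ 1 → ‖S x‖ ≤ δ + C * ‖q (S x)‖ := by
    rcases Set.eq_empty_or_nonempty (closure (S '' Metric.closedBall 0 1) ∩ {y | δ ≤ ‖y‖})
      with he | hne
    · refine ⟨0, le_rfl, fun x hx => ?_⟩
      by_contra! hlt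
      have : S x ∈ closure (S '' Metric.closedBall 0 1) ∩ {y | δ ≤ ‖y‖} :=
        ⟨subset_closure ⟨x, by simpa using hx, rfl⟩, by simp at hlt; exact hlt.le⟩
      rw [he] at this
      exact this
    · obtain ⟨y₀, hy₀, hmin⟩ := hK.exists_isMinOn hne
        (f := fun y => ‖q y‖) (q.continuous.norm.continuousOn)
      have hpos : 0 < ‖q y₀‖ := by
        rw [norm_pos_iff]
        intro h
        have : y₀ = 0 := hq (by rw [h, map_zero])
        have h2 : δ ≤ ‖y₀‖ := hy₀.2
        rw [this, norm_zero] at h2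
        linarith
      refine ⟨‖S‖ / ‖q y₀‖, by positivity, fun x hx => ?_⟩
      by_cases hlt : δ ≤ ‖S x‖
      · have hmem : S x ∈ closure (S '' Metric.closedBall 0 1) ∩ {y | δ ≤ ‖y‖} :=
          ⟨subset_closure ⟨x, by simpa using hx, rfl⟩, hlt⟩
        have h1 : ‖q y₀‖ ≤ ‖q (S x)‖ := hmin hmem
        have h2 : ‖S x‖ ≤ ‖S‖ := (S.le_opNorm x).trans (mul_le_of_le_one_right (norm_nonneg _) hx)
        calc ‖S x‖ ≤ ‖S‖ / ‖q y₀‖ * ‖q y₀‖ := by rwa [div_mul_cancel₀ _ hpos.ne']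
          _ ≤ ‖S‖ / ‖q y₀‖ * ‖q (S x)‖ := by gcongr
          _ ≤ _ := by linarith
      · have : 0 ≤ ‖S‖ / ‖q y₀‖ * ‖q (S x)‖ := by positivity
        linarith
  obtain ⟨C, hC, h⟩ := key
  refine ⟨C, hC, fun x => ?_⟩
  obtain ⟨x', hx', hx⟩ := exists_norm_le_one_eq_smul x
  have h1 : S x = (‖x‖ : ℂ) • S x' := by rw [← map_smul, ← hx]
  have h2 : ‖(‖x‖ : ℂ)‖ = ‖x‖ := by simp
  rw [h1, map_smul, norm_smul, norm_smul, h2]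
  nlinarith [mul_le_mul_of_nonneg_left (h x' hx') (norm_nonneg x)]

/-- Up to a small multiple of `‖x‖`, the norm of `S x`, for a compact operator `S`, is controlled
by finitely many functionals: those norming the points of a finite net. -/
theorem IsCompactOperator.exists_norm_le_add_sum_dual {S : V →L[ℂ] W} (hS : IsCompactOperator S)
    {δ : ℝ} (hδ : 0 < δ) :
    ∃ F : Finset (W →L[ℂ] ℂ), ∀ x, ‖S x‖ ≤ δ * ‖x‖ + ∑ l ∈ F, ‖l (S x)‖ := by
  classical
  have htb : TotallyBounded (S '' Metric.closedBall 0 1) :=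
    ((IsCompactOperator.isCompact_closure_image_closedBall (f := S.toLinearMap) hS
      1).totallyBounded).subset subset_closure
  obtain ⟨t, ht, hcov⟩ := Metric.totallyBounded_iff.1 htb (δ / 2) (by positivity)
  choose g hg1 hg2 using fun y : W => exists_dual_vector'' ℂ y
  refine ⟨ht.toFinset.image g, fun x => ?_⟩
  obtain ⟨x', hx', hx⟩ := exists_norm_le_one_eq_smul x
  have h1 : S x = (‖x‖ : ℂ) • S x' := by rw [← map_smul, ← hx]
  have h2 : ‖(‖x‖ : ℂ)‖ = ‖x‖ := by simp
  obtain ⟨y, hy, hxy⟩ := Set.mem_iUnion₂.1 (hcov ⟨x', by simpa using hx', rfl⟩)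
  rw [Metric.mem_ball, dist_eq_norm] at hxy
  have h3 : ‖S x'‖ ≤ δ + ‖g y (S x')‖ := by
    have e1 : ‖S x'‖ ≤ ‖S x' - y‖ + ‖y‖ := by simpa using norm_add_le (S x' - y) y
    have e2 : ‖y‖ = ‖g y y‖ := by rw [hg2]; simp
    have e3 : ‖g y y‖ ≤ ‖g y (S x' - y)‖ + ‖g y (S x')‖ := by
      have : g y y = g y (S x') - g y (S x' - y) := by rw [map_sub]; ring
      rw [this, add_comm]; exact norm_sub_le _ _
    have e4 : ‖g y (S x' - y)‖ ≤ ‖S x' - y‖ := (g y).le_of_opNorm_le (hg1 y) _ |>.trans (by simp)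
    linarith
  have h4 : ‖g y (S x)‖ ≤ ∑ l ∈ ht.toFinset.image g, ‖l (S x)‖ :=
    Finset.single_le_sum (f := fun l : W →L[ℂ] ℂ => ‖l (S x)‖) (fun _ _ => norm_nonneg _)
      (Finset.mem_image_of_mem g (ht.mem_toFinset.2 hy))
  refine le_trans ?_ (add_le_add_right h4 _)
  rw [h1, map_smul, norm_smul, norm_smul, h2]
  nlinarith [mul_le_mul_of_nonneg_left h3 (norm_nonneg x)]

end Compact

/-! ### Approximation by trigonometric polynomials -/

section Approx

theorem exists_trig_near {X : Type*} [NormedAddCommGroup X] [NormedSpace ℂ X] [CompleteSpace X]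
    (f : C(𝕋, X)) {ε : ℝ} (hε : 0 < ε) : ∃ a : ℤ →₀ X, ∀ t, ‖trig a t - f t‖ ≤ ε := by
  obtain ⟨n, hn⟩ := (Metric.tendsto_nhds.1 (tendsto_kernelMean f) ε hε).exists
  refine ⟨coeffMul (kernelCoeff n) (fourierCoeff f), fun t => ?_⟩
  rw [← kernelMean_eq_trig n f, ← dist_eq_norm]
  exact (ContinuousMap.dist_apply_le_dist t).trans hn.le

/-- If the values of `q` lie near the finitely many points `y j`, then `q` is close to
`∑ ρ j • y j` for a continuous partition of unity `ρ`, and the `ρ j` are close to trigonometric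
polynomials. -/
theorem exists_trig_partition {W : Type*} [NormedAddCommGroup W] [NormedSpace ℂ W] {ι : Type*}
    [Fintype ι] (q : C(𝕋, W)) (y : ι → W) {ε η : ℝ} (hη : 0 < η) (hq : ∀ t, ∃ j, ‖q t - y j‖ < ε) :
    ∃ (ρ : ι → 𝕋 → ℝ) (φ : ι → ℤ →₀ ℂ), (∀ j t, 0 ≤ ρ j t) ∧ (∀ t, ∑ j, ρ j t = 1) ∧
      (∀ t, ‖q t - ∑ j, (ρ j t : ℂ) • y j‖ ≤ ε) ∧ ∀ j t, ‖trig (φ j) t - ρ j t‖ ≤ η := by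
  let ψ : ι → 𝕋 → ℝ := fun j t => max 0 (ε - ‖q t - y j‖)
  have hψ0 : ∀ j t, 0 ≤ ψ j t := fun j t => le_max_left _ _
  have hψc : ∀ j, Continuous (ψ j) := fun j => by fun_prop
  have hs : ∀ t, 0 < ∑ j, ψ j t := fun t => by
    obtain ⟨j, hj⟩ := hq t
    exact Finset.sum_pos' (fun j _ => hψ0 j t)
      ⟨j, Finset.mem_univ _, lt_max_of_lt_right (by linarith)⟩
  let ρ : ι → 𝕋 → ℝ := fun j t => ψ j t / ∑ i, ψ i t
  have hρc : ∀ j, Continuous (ρ j) := fun j =>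
    (hψc j).div (continuous_finsetSum _ fun i _ => hψc i) fun t => (hs t).ne'
  have hρ0 : ∀ j t, 0 ≤ ρ j t := fun j t => div_nonneg (hψ0 j t) (hs t).le
  have hρ1 : ∀ t, ∑ j, ρ j t = 1 := fun t => by
    rw [← Finset.sum_div, div_self (hs t).ne']
  choose φ hφ using fun j => exists_trig_near
    (⟨fun t => (ρ j t : ℂ), Complex.continuous_ofReal.comp (hρc j)⟩ : C(𝕋, ℂ)) hη
  refine ⟨ρ, φ, hρ0, hρ1, fun t => ?_, hφ⟩
  have h1 : q t - ∑ j, (ρ j t : ℂ) • y j = ∑ j, (ρ j t : ℂ) • (q t - y j) := by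
    simp only [smul_sub, Finset.sum_sub_distrib, ← Finset.sum_smul]
    rw [← Complex.ofReal_sum, hρ1, Complex.ofReal_one, one_smul]
  rw [h1]
  calc ‖∑ j, (ρ j t : ℂ) • (q t - y j)‖ ≤ ∑ j, ρ j t * ε := by
        refine (norm_sum_le _ _).trans (Finset.sum_le_sum fun j _ => ?_)
        rw [norm_smul, Complex.norm_real, Real.norm_of_nonneg (hρ0 j t)]
        by_cases hj : ‖q t - y j‖ ≤ ε
        · exact mul_le_mul_of_nonneg_left hj (hρ0 j t)
        · have : ψ j t = 0 := max_eq_left (by linarith)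
          simp [ρ, this]
    _ = ε := by rw [← Finset.sum_mul, hρ1, one_mul]

end Approx

/-! ### Analytic functions on the annulus -/

section Annulus

theorem isOpen_openAnnulus : IsOpen openAnnulus :=
  (isOpen_lt continuous_const continuous_norm).inter (isOpen_lt continuous_norm continuous_const)

theorem openAnnulus_subset_closedAnnulus : openAnnulus ⊆ closedAnnulus :=
  fun _ hz => ⟨hz.1.le, hz.2.le⟩

theorem ne_zero_of_mem_closedAnnulus {z : ℂ} (hz : z ∈ closedAnnulus) : z ≠ 0 :=
  norm_pos_iff.1 (one_pos.trans_le hz.1)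

instance : CompactSpace closedAnnulus :=
  isCompact_iff_compactSpace.1 <| (isCompact_closedBall (0 : ℂ) (Real.exp 1)).of_isClosed_subset
    isClosed_closedAnnulus fun _ hz => mem_closedBall_zero_iff.2 hz.2

theorem isAnalyticInside_iff {V : Type*} [NormedAddCommGroup V] [NormedSpace ℂ V]
    {f : closedAnnulus → V} {g : ℂ → V} (h : ∀ z : closedAnnulus, f z = g z) :
    IsAnalyticInside f ↔ DifferentiableOn ℂ g openAnnulus := by
  refine differentiableOn_congr fun z hz => ?_
  rw [← h ⟨z, openAnnulus_subset_closedAnnulus hz⟩]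
  exact Subtype.val_injective.extend_apply f 0 ⟨z, openAnnulus_subset_closedAnnulus hz⟩

theorem extend_closedAnnulus_apply {V : Type*} [Zero V] (f : closedAnnulus → V)
    (z : closedAnnulus) : Function.extend Subtype.val f 0 (z : ℂ) = f z :=
  Subtype.val_injective.extend_apply f 0 z

/-- The point `e^{2πit}` of the inner circle. -/
def innerCirc (t : 𝕋) : Metric.sphere (0 : ℂ) 1 :=
  ⟨fourier 1 t, mem_sphere_zero_iff_norm.2 (norm_fourier_apply 1 t)⟩

/-- The point `e · e^{2πit}` of the outer circle. -/
def outerCirc (t : 𝕋) : Metric.sphere (0 : ℂ) (Real.exp 1) :=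
  ⟨Real.exp 1 * fourier 1 t, mem_sphere_zero_iff_norm.2 (by
    rw [norm_mul, norm_fourier_apply, mul_one, Complex.norm_real,
      Real.norm_of_nonneg (Real.exp_pos _).le])⟩

theorem continuous_innerCirc : Continuous innerCirc :=
  Continuous.subtype_mk (by fun_prop) _

theorem continuous_outerCirc : Continuous outerCirc :=
  Continuous.subtype_mk (by fun_prop) _

theorem exists_fourier_eq {w : ℂ} (hw : ‖w‖ = 1) : ∃ t : 𝕋, fourier 1 t = w := by
  obtain ⟨t, ht⟩ := (AddCircle.homeomorphCircle (T := (1 : ℝ)) one_ne_zero).surjective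
    ⟨w, mem_sphere_zero_iff_norm.2 hw⟩
  refine ⟨t, ?_⟩
  rw [fourier_one, ← AddCircle.homeomorphCircle_apply one_ne_zero, ht]

theorem innerCirc_surjective : Function.Surjective innerCirc := fun w => by
  obtain ⟨t, ht⟩ := exists_fourier_eq (mem_sphere_zero_iff_norm.1 w.2)
  exact ⟨t, Subtype.ext ht⟩

theorem outerCirc_surjective : Function.Surjective outerCirc := fun w => by
  have h := mem_sphere_zero_iff_norm.1 w.2
  have he : ((Real.exp 1 : ℝ) : ℂ) ≠ 0 := by exact_mod_cast (Real.exp_pos 1).ne'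
  obtain ⟨t, ht⟩ := exists_fourier_eq (w := (w : ℂ) / (Real.exp 1 : ℝ)) (by
    rw [norm_div, h, Complex.norm_real, Real.norm_of_nonneg (Real.exp_pos _).le,
      div_self (Real.exp_pos 1).ne'])
  refine ⟨t, Subtype.ext ?_⟩
  simp only [outerCirc, ht]
  field_simp

/-- The Fourier coefficients of the restriction of `F` to the circle of radius `r` are circle
integrals. -/
theorem fourierCoeff_eq_circleIntegral {V : Type*} [NormedAddCommGroup V] [NormedSpace ℂ V]
    (F : ℂ → V) {r : ℝ} (hr : 0 < r) (k : ℤ) :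
    (2 * Real.pi * Complex.I : ℂ) • fourierCoeff (fun t : 𝕋 => F (r * fourier 1 t)) k =
      (r : ℂ) ^ k • ∮ z in C(0, r), (z - 0)⁻¹ • z ^ (-k) • F z := by
  have hpi : (2 * Real.pi : ℝ) ≠ 0 := by positivity
  have hrc : (r : ℂ) ≠ 0 := by exact_mod_cast hr.ne'
  rw [fourierCoeff_eq_intervalIntegral _ _ 0, circleIntegral]
  have h1 : ∀ x : ℝ, deriv (circleMap 0 r) x • (circleMap 0 r x - 0)⁻¹ • circleMap 0 r x ^ (-k) •
      F (circleMap 0 r x) = Complex.I • (r : ℂ) ^ (-k) • Complex.exp (x * Complex.I) ^ (-k) •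
        F (r * Complex.exp (x * Complex.I)) := by
    intro x
    have hne : circleMap 0 r x ≠ 0 := circleMap_ne_center hr.ne'
    rw [deriv_circleMap, sub_zero, smul_smul, mul_right_comm, mul_inv_cancel₀ hne, one_mul]
    rw [circleMap, zero_add, mul_zpow, mul_smul]
  have h2 : ∀ x : ℝ, fourier 1 (x : 𝕋) = Complex.exp ((2 * Real.pi * x : ℝ) * Complex.I) := by
    intro x
    rw [fourier_coe_apply]; congr 1; push_cast; ring
  have h3 : ∀ x : ℝ, fourier (-k) (x : 𝕋) =
      Complex.exp ((2 * Real.pi * x : ℝ) * Complex.I) ^ (-k) := by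
    intro x
    rw [fourier_coe_apply, ← Complex.exp_int_mul]; congr 1; push_cast; ring
  simp only [h1, h2, h3]
  rw [intervalIntegral.integral_smul, intervalIntegral.integral_smul]
  have h4 := intervalIntegral.integral_comp_mul_left (a := 0) (b := 0 + 1)
    (fun x : ℝ => Complex.exp (x * Complex.I) ^ (-k) • F (r * Complex.exp (x * Complex.I))) hpi
  rw [h4]
  rw [smul_comm ((r : ℂ) ^ k), smul_smul ((r : ℂ) ^ k), ← zpow_add₀ hrc, add_neg_cancel, zpow_zero,
    one_smul, mul_zero, zero_add, mul_one, div_one, one_smul, RCLike.real_smul_eq_coe_smul (K := ℂ),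
    smul_smul]
  congr 1
  simp only [RCLike.ofReal_inv]
  push_cast
  field_simp
  rfl

/-- The Laurent coefficients of a function analytic in the annulus may be computed on either of
the two boundary circles. -/
theorem IsAnalyticInside.fourierCoeff_eq {V : Type*} [NormedAddCommGroup V] [NormedSpace ℂ V]
    {f : C(closedAnnulus, V)} (hf : IsAnalyticInside f) (k : ℤ) :
    fourierCoeff (fun t => f (innerPt (innerCirc t))) k =
      (Real.exp (-k) : ℂ) • fourierCoeff (fun t => f (outerPt (outerCirc t))) k := by
  set F := Function.extend Subtype.val f 0 with hF
  have hcont : ContinuousOn F closedAnnulus := by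
    rw [continuousOn_iff_continuous_domRestrict]
    exact f.continuous.congr fun z => (extend_closedAnnulus_apply f z).symm
  have h0 : ∀ t : 𝕋, f (innerPt (innerCirc t)) = F ((1 : ℝ) * fourier 1 t) := fun t => by
    rw [Complex.ofReal_one, one_mul, ← extend_closedAnnulus_apply f]; rfl
  have h1 : ∀ t : 𝕋, f (outerPt (outerCirc t)) = F (Real.exp 1 * fourier 1 t) := fun t => by
    rw [← extend_closedAnnulus_apply f]; rfl
  have hset : Metric.closedBall (0 : ℂ) (Real.exp 1) \ Metric.ball 0 1 ⊆ closedAnnulus := by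
    rintro z ⟨hz1, hz2⟩
    rw [mem_closedBall_zero_iff] at hz1
    rw [mem_ball_zero_iff, not_lt] at hz2
    exact ⟨hz2, hz1⟩
  have hC :=
    Complex.circleIntegral_sub_center_inv_smul_eq_of_differentiable_on_annulus_off_countable
    (c := 0) (f := fun z => z ^ (-k) • F z) one_pos (Real.one_le_exp zero_le_one)
    Set.countable_empty (fun z hz => by
      refine ContinuousWithinAt.smul ?_ ((hcont z (hset hz)).mono hset)
      exact (continuousAt_zpow₀ z (-k)
        (Or.inl (ne_zero_of_mem_closedAnnulus (hset hz)))).continuousWithinAt)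
    (fun z hz => by
      have hz' : z ∈ openAnnulus := by
        rcases hz with ⟨⟨hz1, hz2⟩, -⟩
        rw [mem_ball_zero_iff] at hz1
        rw [mem_closedBall_zero_iff, not_le] at hz2
        exact ⟨hz2, hz1⟩
      refine DifferentiableAt.smul (differentiableAt_zpow.2 (Or.inl
        (ne_zero_of_mem_closedAnnulus (openAnnulus_subset_closedAnnulus hz'))))
        (hf.differentiableAt (isOpen_openAnnulus.mem_nhds hz')))
  simp only [h0, h1]
  have hne : (2 * Real.pi * Complex.I : ℂ) ≠ 0 := Complex.two_pi_I_ne_zero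
  refine smul_right_injective V hne ?_
  simp only
  rw [smul_comm, fourierCoeff_eq_circleIntegral F one_pos,
    fourierCoeff_eq_circleIntegral F (Real.exp_pos 1), hC, smul_smul]
  congr 1
  rw [Complex.ofReal_one, one_zpow, ← Complex.ofReal_zpow, ← Complex.ofReal_mul,
    ← Real.rpow_intCast, Real.exp_one_rpow, ← Real.exp_add, neg_add_cancel, Real.exp_zero,
    Complex.ofReal_one]

end Annulus

/-! ### Completeness of image spaces -/

namespace ImageSpace

variable {V E : Type*} [NormedAddCommGroup V] [NormedSpace ℂ V]
  [AddCommGroup E] [Module ℂ E] [TopologicalSpace E] [T2Space E] (f : V →L[ℂ] E)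

theorem exists_mk_eq_norm_lt (y : ImageSpace f) {ε : ℝ} (hε : 0 < ε) :
    ∃ v, mk f v = y ∧ ‖v‖ < ‖y‖ + ε := by
  have hne : (norm '' {v : V | f v = val f y}).Nonempty := by
    obtain ⟨v₀, rfl⟩ := mk_surjective f y
    exact ⟨_, v₀, rfl, rfl⟩
  obtain ⟨_, ⟨v, hv, rfl⟩, hlt⟩ := exists_lt_of_csInf_lt hne
    ((norm_eq f y).symm.trans_lt (lt_add_of_pos_right _ hε))
  exact ⟨v, val_injective f hv, hlt⟩

/-- A map out of the image space is bounded if it is bounded on representatives. -/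
theorem le_mul_norm_of_forall_mk {p : ImageSpace f → ℝ} {M : ℝ} (hM : 0 ≤ M)
    (h : ∀ v, p (mk f v) ≤ M * ‖v‖) (y : ImageSpace f) : p y ≤ M * ‖y‖ := by
  refine le_of_forall_pos_le_add fun ε hε => ?_
  obtain ⟨v, rfl, hv⟩ := exists_mk_eq_norm_lt f y (ε := ε / (M + 1)) (by positivity)
  refine (h v).trans ((mul_le_mul_of_nonneg_left hv.le hM).trans ?_)
  rw [mul_add]
  have : M * (ε / (M + 1)) ≤ ε := by
    rw [mul_div_assoc', div_le_iff₀ (by positivity)]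
    nlinarith
  linarith

instance [CompleteSpace V] : CompleteSpace (ImageSpace f) := by
  have hiso : Isometry (toQuot f) :=
    AddMonoidHomClass.isometry_of_norm (toQuot f) fun _ => rfl
  exact (completeSpace_congr (e := (toQuot f).toEquiv) hiso.isUniformEmbedding).2 inferInstance

end ImageSpace

namespace BanachCouple

variable {X₀ X₁ E : Type*}
  [NormedAddCommGroup X₀] [NormedSpace ℂ X₀] [CompleteSpace X₀]
  [NormedAddCommGroup X₁] [NormedSpace ℂ X₁] [CompleteSpace X₁]
  [AddCommGroup E] [Module ℂ E] [TopologicalSpace E] [IsTopologicalAddGroup E]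
  [ContinuousSMul ℂ E] [T2Space E] (C : BanachCouple X₀ X₁ E)

/-! ### The intersection of a couple and the inclusions into the sum -/

/-- The inclusion `X₀ ⊆ X₀ + X₁` as a continuous linear map. -/
def inclCLM₀ : X₀ →L[ℂ] C.SumSpace :=
  C.incl₀.mkContinuous 1 fun x => (C.norm_incl₀_le x).trans (one_mul _).ge

/-- The inclusion `X₁ ⊆ X₀ + X₁` as a continuous linear map. -/
def inclCLM₁ : X₁ →L[ℂ] C.SumSpace :=
  C.incl₁.mkContinuous 1 fun x => (C.norm_incl₁_le x).trans (one_mul _).ge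

@[simp] theorem inclCLM₀_apply (x : X₀) : C.inclCLM₀ x = C.incl₀ x := rfl

@[simp] theorem inclCLM₁_apply (x : X₁) : C.inclCLM₁ x = C.incl₁ x := rfl

theorem incl₀_injective : Function.Injective C.incl₀ := fun x y h => C.ι₀_injective <| by
  rw [← val_incl₀, ← val_incl₀, h]

theorem mk_sumMap (v : WithLp 1 (X₀ × X₁)) :
    ImageSpace.mk C.sumMap v = C.incl₀ v.fst + C.incl₁ v.snd := by
  refine ImageSpace.val_injective C.sumMap ?_
  rw [map_add, val_incl₀, val_incl₁]
  rfl

/-- The intersection `X₀ ∩ X₁`, as the space of pairs `(a, b) ∈ X₀ × X₁` having the same image in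
the ambient space; its norm is the larger of the norms in `X₀` and `X₁`. -/
def inter : Submodule ℂ (X₀ × X₁) where
  carrier := {p | C.incl₀ p.1 = C.incl₁ p.2}
  zero_mem' := by simp
  add_mem' := by
    rintro p q hp hq
    simp only [Set.mem_ofPred_eq, Prod.fst_add, Prod.snd_add, map_add] at *
    rw [hp, hq]
  smul_mem' := by
    rintro c p hp
    simp only [Set.mem_ofPred_eq, Prod.smul_fst, Prod.smul_snd, map_smul] at *
    rw [hp]

/-- The inclusion `X₀ ∩ X₁ ⊆ X₀`. -/
def interFst : C.inter →L[ℂ] X₀ := (ContinuousLinearMap.fst ℂ X₀ X₁).comp C.inter.subtypeL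

/-- The inclusion `X₀ ∩ X₁ ⊆ X₁`. -/
def interSnd : C.inter →L[ℂ] X₁ := (ContinuousLinearMap.snd ℂ X₀ X₁).comp C.inter.subtypeL

theorem incl₀_interFst (x : C.inter) : C.incl₀ (C.interFst x) = C.incl₁ (C.interSnd x) := x.2

theorem norm_interFst_le (x : C.inter) : ‖C.interFst x‖ ≤ ‖x‖ := norm_fst_le (x : X₀ × X₁)

theorem norm_interSnd_le (x : C.inter) : ‖C.interSnd x‖ ≤ ‖x‖ := norm_snd_le (x : X₀ × X₁)

namespace CalF

/-! ### Functions in `𝓕` through their boundary values -/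

/-- The boundary function `t ↦ f (e^{2πit})` with values in `X₀`. -/
def inner : C.CalF →ₗ[ℂ] C(𝕋, X₀) where
  toFun f := (bdry C f).1.comp ⟨innerCirc, continuous_innerCirc⟩
  map_add' f g := by ext t; simp
  map_smul' c f := by ext t; simp

/-- The boundary function `t ↦ f (e · e^{2πit})` with values in `X₁`. -/
def outer : C.CalF →ₗ[ℂ] C(𝕋, X₁) where
  toFun f := (bdry C f).2.comp ⟨outerCirc, continuous_outerCirc⟩
  map_add' f g := by ext t; simp
  map_smul' c f := by ext t; simp

theorem isAnalyticInside_fn (f : C.CalF) : IsAnalyticInside (fn C f) := f.2.1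

theorem fn_innerPt (f : C.CalF) (t : 𝕋) :
    fn C f (innerPt (innerCirc t)) = C.incl₀ (inner C f t) := f.2.2.1 _

theorem fn_outerPt (f : C.CalF) (t : 𝕋) :
    fn C f (outerPt (outerCirc t)) = C.incl₁ (outer C f t) := f.2.2.2 _

theorem norm_le_of_boundary {f : C.CalF} {M : ℝ} (h₀ : ∀ t, ‖inner C f t‖ ≤ M)
    (h₁ : ∀ t, ‖outer C f t‖ ≤ M) : ‖f‖ ≤ M := by
  have hM : 0 ≤ M := (norm_nonneg _).trans (h₀ 0)
  refine max_le ((ContinuousMap.norm_le _ hM).2 fun w => ?_)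
    ((ContinuousMap.norm_le _ hM).2 fun w => ?_)
  · obtain ⟨t, rfl⟩ := innerCirc_surjective w
    exact h₀ t
  · obtain ⟨t, rfl⟩ := outerCirc_surjective w
    exact h₁ t

theorem norm_inner_le (f : C.CalF) (t : 𝕋) : ‖inner C f t‖ ≤ ‖f‖ :=
  (ContinuousMap.norm_coe_le_norm (bdry C f).1 _).trans (norm_fst_le (bdry C f))

theorem norm_outer_le (f : C.CalF) (t : 𝕋) : ‖outer C f t‖ ≤ ‖f‖ :=
  (ContinuousMap.norm_coe_le_norm (bdry C f).2 _).trans (norm_snd_le (bdry C f))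

theorem ext_boundary {f g : C.CalF} (h₀ : inner C f = inner C g) (h₁ : outer C f = outer C g) :
    f = g := by
  rw [← sub_eq_zero, ← norm_le_zero_iff]
  refine norm_le_of_boundary C (fun t => ?_) fun t => ?_ <;> simp [h₀, h₁]

theorem tendsto_of_boundary {ι : Type*} {l : Filter ι} {u : ι → C.CalF} {f : C.CalF}
    (h₀ : Tendsto (fun i => inner C (u i)) l (𝓝 (inner C f)))
    (h₁ : Tendsto (fun i => outer C (u i)) l (𝓝 (outer C f))) : Tendsto u l (𝓝 f) := by
  rw [Metric.tendsto_nhds] at *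
  intro ε hε
  filter_upwards [h₀ (ε / 2) (by positivity), h₁ (ε / 2) (by positivity)] with i hi₀ hi₁
  rw [dist_eq_norm]
  refine (norm_le_of_boundary C (M := ε / 2) (fun t => ?_) fun t => ?_).trans_lt (half_lt_self hε)
  · rw [map_sub, ContinuousMap.sub_apply, ← dist_eq_norm]
    exact (ContinuousMap.dist_apply_le_dist t).trans hi₀.le
  · rw [map_sub, ContinuousMap.sub_apply, ← dist_eq_norm]
    exact (ContinuousMap.dist_apply_le_dist t).trans hi₁.le

theorem cauchySeq_fn {u : ℕ → C.CalF} (hu : CauchySeq u) : CauchySeq fun n => fn C (u n) := by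
  rw [Metric.cauchySeq_iff] at *
  intro ε hε
  obtain ⟨N, hN⟩ := hu (ε / 2) (by positivity)
  refine ⟨N, fun m hm n hn => lt_of_le_of_lt ?_ (half_lt_self hε)⟩
  rw [ContinuousMap.dist_le (by positivity)]
  intro z
  have h := norm_fn_le C (u m - u n) z
  rw [map_sub, ContinuousMap.sub_apply, ← dist_eq_norm] at h
  exact h.trans ((dist_eq_norm (u m) (u n)).symm.trans_le (hN m hm n hn).le)

instance : CompleteSpace C.CalF := by
  refine Metric.complete_of_cauchySeq_tendsto fun u hu => ?_
  have hb : CauchySeq fun n => bdry C (u n) :=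
    (AddMonoidHomClass.isometry_of_norm (bdry C) fun _ => rfl).uniformContinuous.comp_cauchySeq hu
  obtain ⟨b, hb⟩ := cauchySeq_tendsto_of_complete hb
  obtain ⟨F, hF⟩ := cauchySeq_tendsto_of_complete (cauchySeq_fn C hu)
  have hFz : ∀ z, Tendsto (fun n => fn C (u n) z) atTop (𝓝 (F z)) := fun z =>
    ((ContinuousMap.evalCLM ℂ z).continuous.tendsto F).comp hF
  have hb₀ : ∀ w, Tendsto (fun n => (bdry C (u n)).1 w) atTop (𝓝 (b.1 w)) := fun w =>
    (((ContinuousMap.evalCLM ℂ w).continuous.comp continuous_fst).tendsto b).comp hb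
  have hb₁ : ∀ w, Tendsto (fun n => (bdry C (u n)).2 w) atTop (𝓝 (b.2 w)) := fun w =>
    (((ContinuousMap.evalCLM ℂ w).continuous.comp continuous_snd).tendsto b).comp hb
  have hFan : IsAnalyticInside F := by
    have hloc : TendstoUniformlyOn (fun n => Function.extend Subtype.val (fn C (u n)) 0)
        (Function.extend Subtype.val F 0) atTop openAnnulus := by
      rw [Metric.tendstoUniformlyOn_iff]
      intro ε hε
      filter_upwards [Metric.tendsto_nhds.1 hF ε hε] with n hn z hz
      have e := fun g : closedAnnulus → C.SumSpace =>
        extend_closedAnnulus_apply g ⟨z, openAnnulus_subset_closedAnnulus hz⟩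
      simp only at e
      rw [e, e, dist_comm]
      exact (ContinuousMap.dist_apply_le_dist _).trans_lt hn
    exact hloc.tendstoLocallyUniformlyOn.differentiableOn
      (Eventually.of_forall fun n => isAnalyticInside_fn C (u n)) isOpen_openAnnulus
  let f : C.CalF := ⟨(F, b), hFan,
    fun w => tendsto_nhds_unique (hFz _) <| by
      have := (C.inclCLM₀.continuous.tendsto _).comp (hb₀ w)
      exact this.congr fun n => ((u n).2.2.1 w).symm,
    fun w => tendsto_nhds_unique (hFz _) <| by
      have := (C.inclCLM₁.continuous.tendsto _).comp (hb₁ w)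
      exact this.congr fun n => ((u n).2.2.2 w).symm⟩
  refine ⟨f, ?_⟩
  rw [tendsto_iff_dist_tendsto_zero] at hb ⊢
  exact hb

/-! ### Multiplication by scalar functions, and Laurent polynomials -/

/-- The product of a function in `𝓕` with a scalar function analytic in the annulus. -/
def mulAnalytic (m : ℂ → ℂ) (hc : ContinuousOn m closedAnnulus)
    (hd : DifferentiableOn ℂ m openAnnulus) (f : C.CalF) : C.CalF :=
  ⟨(⟨fun z => m z • fn C f z,
      (continuousOn_iff_continuous_domRestrict.1 hc).smul (fn C f).continuous⟩,
    ⟨fun w => m w • (bdry C f).1 w, by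
      refine Continuous.smul ?_ (bdry C f).1.continuous
      exact (continuousOn_iff_continuous_domRestrict.1 hc).comp
        (continuous_subtype_val.subtype_mk fun w => (innerPt w).2)⟩,
    ⟨fun w => m w • (bdry C f).2 w, by
      refine Continuous.smul ?_ (bdry C f).2.continuous
      exact (continuousOn_iff_continuous_domRestrict.1 hc).comp
        (continuous_subtype_val.subtype_mk fun w => (outerPt w).2)⟩), by
    refine ⟨?_, fun w => ?_, fun w => ?_⟩
    · rw [isAnalyticInside_iff (g := fun z => m z • Function.extend Subtype.val (fn C f) 0 z)
        fun z => by rw [extend_closedAnnulus_apply]; rfl]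
      exact hd.smul (isAnalyticInside_fn C f)
    · have : fn C f (innerPt w) = C.incl₀ ((bdry C f).1 w) := f.2.2.1 w
      change m w • fn C f (innerPt w) = C.incl₀ (m w • (bdry C f).1 w)
      rw [this, map_smul]
    · have : fn C f (outerPt w) = C.incl₁ ((bdry C f).2 w) := f.2.2.2 w
      change m w • fn C f (outerPt w) = C.incl₁ (m w • (bdry C f).2 w)
      rw [this, map_smul]⟩

theorem fn_mulAnalytic {m : ℂ → ℂ} (hc : ContinuousOn m closedAnnulus)
    (hd : DifferentiableOn ℂ m openAnnulus) (f : C.CalF) (z : closedAnnulus) :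
    fn C (mulAnalytic C m hc hd f) z = m z • fn C f z := rfl

theorem inner_mulAnalytic {m : ℂ → ℂ} (hc : ContinuousOn m closedAnnulus)
    (hd : DifferentiableOn ℂ m openAnnulus) (f : C.CalF) (t : 𝕋) :
    inner C (mulAnalytic C m hc hd f) t = m (fourier 1 t) • inner C f t := rfl

theorem outer_mulAnalytic {m : ℂ → ℂ} (hc : ContinuousOn m closedAnnulus)
    (hd : DifferentiableOn ℂ m openAnnulus) (f : C.CalF) (t : 𝕋) :
    outer C (mulAnalytic C m hc hd f) t = m (Real.exp 1 * fourier 1 t) • outer C f t := rfl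

/-- The constant function with value in `X₀ ∩ X₁`. -/
def const : C.inter →ₗ[ℂ] C.CalF where
  toFun x := ⟨(ContinuousMap.const _ (C.incl₀ (C.interFst x)),
    ContinuousMap.const _ (C.interFst x), ContinuousMap.const _ (C.interSnd x)), by
      refine ⟨?_, fun w => rfl, fun w => C.incl₀_interFst x⟩
      exact (isAnalyticInside_iff (g := fun _ => C.incl₀ (C.interFst x)) fun z => rfl).2
        (differentiableOn_const _)⟩
  map_add' x y := by
    refine ext_boundary C ?_ ?_ <;> ext t
    · exact map_add C.interFst x y
    · exact map_add C.interSnd x y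
  map_smul' c x := by
    refine ext_boundary C ?_ ?_ <;> ext t
    · exact map_smul C.interFst c x
    · exact map_smul C.interSnd c x

theorem continuousOn_zpow (k : ℤ) : ContinuousOn (fun z : ℂ => z ^ k) closedAnnulus := fun _ hz =>
  (continuousAt_zpow₀ _ k (Or.inl (ne_zero_of_mem_closedAnnulus hz))).continuousWithinAt

theorem differentiableOn_zpow (k : ℤ) : DifferentiableOn ℂ (fun z : ℂ => z ^ k) openAnnulus :=
  fun _ hz => (differentiableAt_zpow.2 (Or.inl (ne_zero_of_mem_closedAnnulus
    (openAnnulus_subset_closedAnnulus hz)))).differentiableWithinAt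

theorem fourier_one_zpow (k : ℤ) (t : 𝕋) : fourier 1 t ^ k = fourier k t := by
  rw [fourier_one, fourier_apply, toCircle_zsmul, Circle.coe_zpow]

/-- The Laurent polynomial `∑ a k • z ^ k` with coefficients in `X₀ ∩ X₁`. -/
def laurent : (ℤ →₀ C.inter) →ₗ[ℂ] C.CalF :=
  Finsupp.lsum ℂ fun k =>
    { toFun := fun x => mulAnalytic C _ (continuousOn_zpow k) (differentiableOn_zpow k) (const C x)
      map_add' := fun x y => by
        refine ext_boundary C ?_ ?_ <;> ext t <;>
          simp [inner_mulAnalytic, outer_mulAnalytic]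
      map_smul' := fun c x => by
        refine ext_boundary C ?_ ?_ <;> ext t <;>
          simp [inner_mulAnalytic, outer_mulAnalytic, smul_comm c] }

/-- The coefficients of a Laurent polynomial as elements of `X₀`. -/
def innerCoeff : (ℤ →₀ C.inter) →ₗ[ℂ] (ℤ →₀ X₀) :=
  Finsupp.mapRange.linearMap C.interFst.toLinearMap

/-- The coefficients of a Laurent polynomial as elements of `X₁`, multiplied by `e ^ k`. -/
def outerCoeff : (ℤ →₀ C.inter) →ₗ[ℂ] (ℤ →₀ X₁) :=
  Finsupp.lsum ℂ fun k =>
    ((Real.exp k : ℝ) : ℂ) • (Finsupp.lsingle k ∘ₗ C.interSnd.toLinearMap)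

@[simp] theorem innerCoeff_apply (a : ℤ →₀ C.inter) (k : ℤ) :
    innerCoeff C a k = C.interFst (a k) := rfl

@[simp] theorem outerCoeff_apply (a : ℤ →₀ C.inter) (k : ℤ) :
    outerCoeff C a k = ((Real.exp k : ℝ) : ℂ) • C.interSnd (a k) := by
  induction a using Finsupp.induction_linear with
  | zero => simp
  | add a b ha hb => simp only [map_add, Finsupp.add_apply, smul_add, ha, hb]
  | single j x =>
    simp only [outerCoeff, Finsupp.lsum_single, LinearMap.smul_apply, LinearMap.comp_apply,
      Finsupp.lsingle_apply, Finsupp.smul_apply, Finsupp.single_apply]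
    split_ifs with h
    · subst h; rfl
    · simp

theorem inner_laurent (a : ℤ →₀ C.inter) : inner C (laurent C a) = trig (innerCoeff C a) := by
  induction a using Finsupp.induction_linear with
  | zero => simp
  | add a b ha hb => simp only [map_add, ha, hb]
  | single k x =>
    ext t
    simp only [laurent, Finsupp.lsum_single, LinearMap.coe_mk, AddHom.coe_mk, inner_mulAnalytic,
      innerCoeff, Finsupp.mapRange.linearMap_apply, Finsupp.mapRange_single, trig_single_apply,
      fourier_one_zpow]
    rfl

theorem exp_mul_fourier_zpow (k : ℤ) (t : 𝕋) :
    ((Real.exp 1 : ℝ) * fourier 1 t : ℂ) ^ k = (Real.exp k : ℝ) * fourier k t := by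
  rw [mul_zpow, fourier_one_zpow, ← Complex.ofReal_zpow, ← Real.rpow_intCast, Real.exp_one_rpow]

theorem outer_laurent (a : ℤ →₀ C.inter) : outer C (laurent C a) = trig (outerCoeff C a) := by
  induction a using Finsupp.induction_linear with
  | zero => simp
  | add a b ha hb => simp only [map_add, ha, hb]
  | single k x =>
    ext t
    simp only [laurent, Finsupp.lsum_single, LinearMap.coe_mk, AddHom.coe_mk, outer_mulAnalytic,
      exp_mul_fourier_zpow, outerCoeff, LinearMap.smul_apply, LinearMap.comp_apply,
      Finsupp.lsingle_apply, map_smul, ContinuousMap.smul_apply, trig_single_apply, mul_smul]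
    rfl

/-- The Laurent coefficients of a function in `𝓕`; they lie in `X₀ ∩ X₁`. -/
def coeff (f : C.CalF) (k : ℤ) : C.inter :=
  ⟨(fourierCoeff (inner C f) k, ((Real.exp (-k) : ℝ) : ℂ) • fourierCoeff (outer C f) k), by
    have h := (isAnalyticInside_fn C f).fourierCoeff_eq k
    simp only [fn_innerPt, fn_outerPt] at h
    have h₀ := C.inclCLM₀.fourierCoeff_comp (integrable_continuousMap (inner C f)) k
    have h₁ := C.inclCLM₁.fourierCoeff_comp (integrable_continuousMap (outer C f)) k
    simp only [inclCLM₀_apply, inclCLM₁_apply] at h₀ h₁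
    rw [h₀, h₁] at h
    change C.incl₀ _ = C.incl₁ _
    rw [map_smul, h]⟩

theorem interFst_coeff (f : C.CalF) (k : ℤ) :
    C.interFst (coeff C f k) = fourierCoeff (inner C f) k := rfl

theorem interSnd_coeff (f : C.CalF) (k : ℤ) :
    C.interSnd (coeff C f k) = ((Real.exp (-k) : ℝ) : ℂ) • fourierCoeff (outer C f) k := rfl

/-- Laurent polynomials are dense in `𝓕`: the averages of `f` over rotations converge to `f`. -/
theorem tendsto_laurent_coeff (f : C.CalF) :
    Tendsto (fun n => laurent C (coeffMul (kernelCoeff n) (coeff C f))) atTop (𝓝 f) := by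
  refine tendsto_of_boundary C ?_ ?_
  · refine (tendsto_kernelMean (inner C f)).congr fun n => ?_
    rw [inner_laurent, kernelMean_eq_trig]
    congr 1
    ext k
    rw [innerCoeff_apply, coeffMul_apply, coeffMul_apply, map_smul, interFst_coeff]
  · refine (tendsto_kernelMean (outer C f)).congr fun n => ?_
    rw [outer_laurent, kernelMean_eq_trig]
    congr 1
    ext k
    rw [outerCoeff_apply, coeffMul_apply, coeffMul_apply, map_smul, smul_comm]
    congr 1
    rw [interSnd_coeff, smul_smul, ← Complex.ofReal_mul, ← Real.exp_add, add_neg_cancel,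
      Real.exp_zero, Complex.ofReal_one, one_smul]

end CalF
end BanachCouple

/-! ### Geometric sums over the integers -/

section Geometric

/-- A bound for two-sided geometric series with ratio `e^{-α}`. -/
def geomBound (α : ℝ) : ℝ := 2 / (1 - Real.exp (-α))

theorem geomBound_pos {α : ℝ} (hα : 0 < α) : 0 < geomBound α := by
  have : Real.exp (-α) < 1 := Real.exp_lt_one_iff.2 (by linarith)
  exact div_pos two_pos (by linarith)

theorem sum_exp_natAbs_le {α : ℝ} (hα : 0 < α) (s : Finset ℤ) :
    ∑ k ∈ s, Real.exp (-α) ^ k.natAbs ≤ geomBound α := by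
  have hr0 := (Real.exp_pos (-α)).le
  have hr1 : Real.exp (-α) < 1 := Real.exp_lt_one_iff.2 (by linarith)
  set r := Real.exp (-α)
  have h1 := hasSum_geometric_of_lt_one hr0 hr1
  have h2 := h1.mul_left r
  have h3 : HasSum (fun k : ℤ => r ^ k.natAbs) ((1 - r)⁻¹ + r * (1 - r)⁻¹) := by
    refine HasSum.of_nat_of_neg_add_one (by simpa using h1) ?_
    have h4 : (fun n : ℕ => r ^ (-((n : ℤ) + 1)).natAbs) = fun n => r * r ^ n := by
      ext n
      rw [Int.natAbs_neg, ← pow_succ']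
      congr 1
    rw [h4]
    exact h2
  refine (sum_le_hasSum s (fun k _ => by positivity) h3).trans ?_
  have : 0 < 1 - r := by linarith
  rw [geomBound, div_eq_mul_inv]
  nlinarith [inv_pos.2 this]

theorem sum_exp_le_of_le {α : ℝ} (hα : 0 < α) (s : Finset ℤ) {M : ℤ} (h : ∀ k ∈ s, k ≤ M) :
    ∑ k ∈ s, Real.exp (α * k) ≤ Real.exp (α * M) * geomBound α := by
  have h1 := sum_exp_natAbs_le hα (s.map (Equiv.addRight (-M)).toEmbedding)
  rw [Finset.sum_map] at h1
  refine le_trans (le_of_eq ?_) (mul_le_mul_of_nonneg_left h1 (Real.exp_pos _).le)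
  rw [Finset.mul_sum]
  refine Finset.sum_congr rfl fun k hk => ?_
  rw [← Real.exp_nat_mul, ← Real.exp_add]
  congr 1
  have h2 : (((k + -M).natAbs : ℕ) : ℝ) = M - k := by
    rw [Nat.cast_natAbs, abs_of_nonpos (by have := h k hk; omega)]
    push_cast; ring
  simp only [Equiv.coe_toEmbedding, Equiv.coe_addRight, h2]
  ring

theorem sum_exp_le_of_ge {α : ℝ} (hα : 0 < α) (s : Finset ℤ) {M : ℤ} (h : ∀ k ∈ s, M ≤ k) :
    ∑ k ∈ s, Real.exp (-(α * k)) ≤ Real.exp (-(α * M)) * geomBound α := by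
  have h1 := sum_exp_le_of_le hα (s.map (Equiv.neg ℤ).toEmbedding) (M := -M) (by
    intro k hk
    obtain ⟨j, hj, rfl⟩ := Finset.mem_map.1 hk
    simpa using h j hj)
  rw [Finset.sum_map] at h1
  simpa using h1

end Geometric

/-! ### Analytic majorants of continuous functions on the circle -/

section Majorant

open scoped ComplexConjugate

/-- For a trigonometric polynomial with coefficients `c`, the polynomial in `w = z⁻¹` whose real
part on `|z| = 1` is the real part of `trig c`: the positive frequencies are conjugated. -/
def reflected (c : ℤ →₀ ℂ) (w : ℂ) : ℂ :=
  c.sum fun k x => (if 0 < k then conj x else x) * w ^ k.natAbs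

theorem differentiable_reflected (c : ℤ →₀ ℂ) : Differentiable ℂ (reflected c) := by
  unfold reflected Finsupp.sum
  fun_prop

theorem re_reflected (c : ℤ →₀ ℂ) (t : 𝕋) :
    (reflected c (fourier 1 t)⁻¹).re = (trig c t).re := by
  rw [reflected, trig_apply, Finsupp.sum, Finsupp.sum, Complex.re_sum, Complex.re_sum]
  refine Finset.sum_congr rfl fun k _ => ?_
  have h : ((fourier 1 t)⁻¹ : ℂ) = fourier (-1) t := by
    rw [fourier_neg]; exact Complex.inv_eq_conj (norm_fourier_apply 1 t)
  have h2 : ((fourier 1 t)⁻¹ : ℂ) ^ k.natAbs = fourier (-(k.natAbs : ℤ)) t := by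
    rw [inv_pow, ← zpow_natCast, ← zpow_neg, BanachCouple.CalF.fourier_one_zpow]
  rw [h2]
  split_ifs with hk
  · rw [fourier_neg, ← map_mul, Complex.conj_re, Int.natCast_natAbs, abs_of_pos hk, smul_eq_mul,
      mul_comm]
  · rw [Int.natCast_natAbs, abs_of_nonpos (not_lt.1 hk), neg_neg, smul_eq_mul, mul_comm]

/-- The maximum principle for the real part, applied through `exp (-·)`. -/
theorem le_re_reflected {c : ℤ →₀ ℂ} {r : ℝ} (h : ∀ t, r ≤ (trig c t).re) {w : ℂ} (hw : ‖w‖ ≤ 1) :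
    r ≤ (reflected c w).re := by
  have hd : Differentiable ℂ fun w => Complex.exp (-reflected c w) :=
    (differentiable_reflected c).neg.cexp
  have := Complex.norm_le_of_forall_mem_frontier_norm_le (U := Metric.ball (0 : ℂ) 1)
    (C := Real.exp (-r)) Metric.isBounded_ball hd.diffContOnCl (fun z hz => by
      rw [frontier_ball _ one_ne_zero, mem_sphere_zero_iff_norm] at hz
      obtain ⟨t, ht⟩ := exists_fourier_eq (w := z⁻¹) (by rw [norm_inv, hz, inv_one])
      rw [← inv_inv z, ← ht, Complex.norm_exp, Complex.neg_re, re_reflected]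
      exact Real.exp_le_exp.2 (neg_le_neg (h t)))
    (z := w) (by rw [closure_ball _ one_ne_zero]; simpa using hw)
  rw [Complex.norm_exp, Complex.neg_re, Real.exp_le_exp] at this
  linarith

theorem norm_reflected_le {c : ℤ →₀ ℂ} {M α : ℝ} (hα : 0 < α) (h : ∀ k, ‖c k‖ ≤ M) :
    ‖reflected c (Real.exp (-α) : ℝ)‖ ≤ M * geomBound α := by
  have hM : 0 ≤ M := (norm_nonneg _).trans (h 0)
  refine le_trans ?_ (mul_le_mul_of_nonneg_left (sum_exp_natAbs_le hα c.support) hM)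
  rw [Finset.mul_sum]
  refine (norm_sum_le _ _).trans (Finset.sum_le_sum fun k _ => ?_)
  rw [norm_mul, norm_pow, Complex.norm_real, Real.norm_of_nonneg (Real.exp_pos _).le]
  refine mul_le_mul_of_nonneg_right ?_ (by positivity)
  split_ifs
  · rw [RCLike.norm_conj]; exact h k
  · exact h k

/-- A nonnegative continuous function `u` on the circle with mean at most `1` has an analytic
majorant outside the circle: its real part is at least `1` for `|z| ≥ 1` and at least `u` for
`|z| = 1`, while its value at `e^α` is bounded by a constant. -/
theorem exists_majorant {u : 𝕋 → ℝ} (hu : Continuous u) (hu0 : ∀ t, 0 ≤ u t)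
    (hu1 : ∫ t, u t ∂haar𝕋 ≤ 1) {α : ℝ} (hα : 0 < α) :
    ∃ P : ℂ → ℂ, Differentiable ℂ P ∧ (∀ w, ‖w‖ ≤ 1 → 1 ≤ ‖P w‖) ∧
      (∀ t, u t ≤ ‖P (fourier 1 t)⁻¹‖) ∧ ‖P (Real.exp (-α) : ℝ)‖ ≤ 4 * geomBound α := by
  have hint : ∀ {v : 𝕋 → ℝ}, Continuous v → Integrable v haar𝕋 := fun hv =>
    hv.integrable_of_hasCompactSupport (HasCompactSupport.of_compactSpace _)
  obtain ⟨c, hc⟩ := exists_trig_near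
    (⟨fun t => ((2 + u t : ℝ) : ℂ), by fun_prop⟩ : C(𝕋, ℂ)) one_pos
  have hre : ∀ t, 1 + u t ≤ (trig c t).re := fun t => by
    have h1 := (abs_le.1 ((Complex.abs_re_le_norm _).trans (hc t))).1
    simp only [ContinuousMap.coe_mk, Complex.sub_re, Complex.ofReal_re] at h1
    linarith
  have hck : ∀ k, ‖c k‖ ≤ 4 := fun k => by
    rw [← fourierCoeff_trig c k]
    refine (norm_fourierCoeff_le_integral _ k).trans ?_
    calc ∫ t, ‖trig c t‖ ∂haar𝕋 ≤ ∫ t, (3 + u t) ∂haar𝕋 := by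
          refine integral_mono (integrable_continuousMap _).norm (hint (by fun_prop)) fun t => ?_
          have h1 : ‖trig c t‖ ≤ ‖trig c t - ((2 + u t : ℝ) : ℂ)‖ + ‖((2 + u t : ℝ) : ℂ)‖ := by
            simpa using norm_add_le (trig c t - ((2 + u t : ℝ) : ℂ)) ((2 + u t : ℝ) : ℂ)
          have h2 := hc t
          simp only [ContinuousMap.coe_mk] at h2
          rw [Complex.norm_real, Real.norm_of_nonneg (by linarith [hu0 t])] at h1
          simp only
          linarith
      _ = 3 + ∫ t, u t ∂haar𝕋 := by
          rw [integral_add (integrable_const _) (hint hu)]; simp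
      _ ≤ 4 := by linarith
  refine ⟨reflected c, differentiable_reflected c, fun w hw => ?_, fun t => ?_,
    norm_reflected_le hα hck⟩
  · exact (le_re_reflected (r := 1) (fun t => by linarith [hre t, hu0 t]) hw).trans
      (Complex.re_le_norm _)
  · refine le_trans ?_ (Complex.re_le_norm _)
    rw [re_reflected]
    linarith [hre t]

end Majorant

namespace BanachCouple

variable {X₀ X₁ E : Type*}
  [NormedAddCommGroup X₀] [NormedSpace ℂ X₀] [CompleteSpace X₀]
  [NormedAddCommGroup X₁] [NormedSpace ℂ X₁] [CompleteSpace X₁]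
  [AddCommGroup E] [Module ℂ E] [TopologicalSpace E] [IsTopologicalAddGroup E]
  [ContinuousSMul ℂ E] [T2Space E] (C : BanachCouple X₀ X₁ E)

/-! ### Values at `e ^ θ` in the interpolation space -/

/-- The value `f (e ^ θ)` as an element of the interpolation space. -/
def value (θ : Set.Icc (0 : ℝ) 1) : C.CalF →ₗ[ℂ] C.Interp θ := ImageSpace.mk (C.evalAt θ)

theorem norm_value_le (θ : Set.Icc (0 : ℝ) 1) (f : C.CalF) : ‖C.value θ f‖ ≤ ‖f‖ :=
  ImageSpace.norm_mk_le _ _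

theorem value_mulAnalytic (θ : Set.Icc (0 : ℝ) 1) {m : ℂ → ℂ} (hc : ContinuousOn m closedAnnulus)
    (hd : DifferentiableOn ℂ m openAnnulus) (f : C.CalF) :
    C.value θ (CalF.mulAnalytic C m hc hd f) = m (Real.exp θ : ℝ) • C.value θ f := by
  refine ImageSpace.val_injective (C.evalAt θ) ?_
  rw [map_smul]
  exact CalF.fn_mulAnalytic C hc hd f (expPt θ)

theorem value_laurent (θ : Set.Icc (0 : ℝ) 1) (a : ℤ →₀ C.inter) :
    C.value θ (CalF.laurent C a) =
      a.sum fun k x => ((Real.exp (θ * k) : ℝ) : ℂ) • C.value θ (CalF.const C x) := by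
  rw [CalF.laurent, Finsupp.lsum_apply, Finsupp.sum, map_sum]
  refine Finset.sum_congr rfl fun k _ => ?_
  refine (value_mulAnalytic C θ _ _ _).trans ?_
  rw [← Complex.ofReal_zpow, ← Real.rpow_intCast, ← Real.exp_mul]

theorem norm_value_const_le (θ : Set.Icc (0 : ℝ) 1) (x : C.inter) :
    ‖C.value θ (CalF.const C x)‖ ≤ ‖x‖ :=
  (C.norm_value_le θ _).trans <| CalF.norm_le_of_boundary C (fun _ => C.norm_interFst_le x)
    fun _ => C.norm_interSnd_le x

/-- A three-lines estimate with the mean, instead of the maximum, of the norm on the inner circle: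
`f` is divided by an analytic majorant of its norm there. The integer `n` balances the two
boundary circles. -/
theorem norm_value_le_of_integral_le {θ : Set.Icc (0 : ℝ) 1} (hθ : 0 < (θ : ℝ)) {f : C.CalF}
    {η B : ℝ} (hη : 0 < η) (h₀ : ∫ t, ‖CalF.inner C f t‖ ∂haar𝕋 ≤ η)
    (h₁ : ∀ t, ‖CalF.outer C f t‖ ≤ B) (n : ℕ) :
    ‖C.value θ f‖ ≤ 4 * geomBound θ *
      max (Real.exp (n * θ) * η) (Real.exp (-(n * (1 - θ))) * B) := by
  have hB : 0 ≤ B := (norm_nonneg _).trans (h₁ 0)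
  have hK := (geomBound_pos hθ).le
  obtain ⟨P, hP, hP1, hPu, hPθ⟩ := exists_majorant (u := fun t => ‖CalF.inner C f t‖ / η)
    (by fun_prop) (fun t => by positivity) (by rwa [integral_div, div_le_one hη]) hθ
  have hinv : ∀ {z : ℂ}, z ∈ closedAnnulus → ‖z⁻¹‖ ≤ 1 := fun hz => by
    rw [norm_inv]; exact inv_le_one_of_one_le₀ hz.1
  have hP0 : ∀ {z : ℂ}, z ∈ closedAnnulus → P z⁻¹ ≠ 0 := fun hz =>
    norm_pos_iff.1 (one_pos.trans_le (hP1 _ (hinv hz)))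
  -- the multiplier takes the value `1` at `e ^ θ`
  let m : ℂ → ℂ := fun z => (Real.exp (n * θ) : ℝ) * z ^ (-(n : ℤ)) *
    (P (Real.exp (-θ) : ℝ) / P z⁻¹)
  have hd : DifferentiableOn ℂ m closedAnnulus := fun z hz => by
    have hz0 := ne_zero_of_mem_closedAnnulus hz
    refine DifferentiableAt.differentiableWithinAt ?_
    have e1 : DifferentiableAt ℂ (fun z : ℂ => z ^ (-(n : ℤ))) z :=
      differentiableAt_zpow.2 (Or.inl hz0)
    have e2 : DifferentiableAt ℂ (fun z : ℂ => P z⁻¹) z :=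
      (hP _).comp z (differentiableAt_inv hz0)
    exact (e1.const_mul _).mul ((differentiableAt_const _).div e2 (hP0 hz))
  have hv : C.value θ (CalF.mulAnalytic C m hd.continuousOn
      (hd.mono openAnnulus_subset_closedAnnulus) f) = C.value θ f := by
    rw [value_mulAnalytic]
    have hmem : ((Real.exp θ : ℝ) : ℂ) ∈ closedAnnulus := (expPt θ).2
    have e0 : ((Real.exp (-θ) : ℝ) : ℂ) = ((Real.exp θ : ℝ) : ℂ)⁻¹ := by
      rw [Real.exp_neg, Complex.ofReal_inv]
    have e1 : m (Real.exp θ : ℝ) = 1 := by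
      simp only [m, e0]
      rw [div_self (hP0 hmem), mul_one, ← Complex.ofReal_zpow, ← Real.rpow_intCast, ← Real.exp_mul,
        ← Complex.ofReal_mul, ← Real.exp_add]
      push_cast
      simp [mul_comm]
    rw [e1, one_smul]
  rw [← hv]
  refine (C.norm_value_le θ _).trans (CalF.norm_le_of_boundary C (fun t => ?_) fun t => ?_)
  · rw [CalF.inner_mulAnalytic, norm_smul]
    have hmem : (fourier 1 t : ℂ) ∈ closedAnnulus := (innerPt (innerCirc t)).2
    have hpos : ‖P (fourier 1 t)⁻¹‖ ≠ 0 := norm_ne_zero_iff.2 (hP0 hmem)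
    have e1 : ‖m (fourier 1 t)‖ = Real.exp (n * θ) *
        (‖P (Real.exp (-θ) : ℝ)‖ / ‖P (fourier 1 t)⁻¹‖) := by
      simp only [m, norm_mul, norm_div, norm_zpow, norm_fourier_apply, one_zpow, mul_one,
        Complex.norm_real, Real.norm_of_nonneg (Real.exp_pos _).le]
    have e2 : ‖CalF.inner C f t‖ ≤ η * ‖P (fourier 1 t)⁻¹‖ := by
      have := hPu t
      rwa [div_le_iff₀ hη, mul_comm] at this
    rw [e1]
    calc Real.exp (n * θ) * (‖P (Real.exp (-θ) : ℝ)‖ / ‖P (fourier 1 t)⁻¹‖) * ‖CalF.inner C f t‖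
        ≤ Real.exp (n * θ) * (‖P (Real.exp (-θ) : ℝ)‖ / ‖P (fourier 1 t)⁻¹‖) *
          (η * ‖P (fourier 1 t)⁻¹‖) := by gcongr
      _ = ‖P (Real.exp (-θ) : ℝ)‖ * (Real.exp (n * θ) * η) := by
          generalize ‖P (fourier 1 t)⁻¹‖ = p at hpos
          field_simp
      _ ≤ 4 * geomBound θ * (Real.exp (n * θ) * η) := by gcongr
      _ ≤ _ := by gcongr; exact le_max_left _ _
  · rw [CalF.outer_mulAnalytic, norm_smul]
    have hmem : ((Real.exp 1 : ℝ) * fourier 1 t : ℂ) ∈ closedAnnulus := (outerPt (outerCirc t)).2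
    have e1 : ‖m ((Real.exp 1 : ℝ) * fourier 1 t)‖ = Real.exp (-(n * (1 - θ))) *
        (‖P (Real.exp (-θ) : ℝ)‖ / ‖P ((Real.exp 1 : ℝ) * fourier 1 t)⁻¹‖) := by
      simp only [m, norm_mul, norm_div, norm_zpow, norm_fourier_apply, mul_one,
        Complex.norm_real, Real.norm_of_nonneg (Real.exp_pos _).le]
      rw [← Real.rpow_intCast, ← Real.exp_mul, ← Real.exp_add]
      congr 2
      push_cast; ring
    rw [e1]
    calc Real.exp (-(n * (1 - θ))) * (‖P (Real.exp (-θ) : ℝ)‖ /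
          ‖P ((Real.exp 1 : ℝ) * fourier 1 t)⁻¹‖) * ‖CalF.outer C f t‖
        ≤ Real.exp (-(n * (1 - θ))) * (4 * geomBound θ) * B := by
          gcongr
          · exact (div_le_self (norm_nonneg _) (hP1 _ (hinv hmem))).trans hPθ
          · exact h₁ t
      _ = 4 * geomBound θ * (Real.exp (-(n * (1 - θ))) * B) := by ring
      _ ≤ _ := by gcongr; exact le_max_right _ _

/-- If the mean of the norm on the inner circle is small enough in terms of a bound on the outer
circle, then the value at `e ^ θ` is small. -/
theorem exists_norm_value_le {θ : Set.Icc (0 : ℝ) 1} (hθ₀ : 0 < (θ : ℝ)) (hθ₁ : (θ : ℝ) < 1) (B : ℝ)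
    {ε : ℝ} (hε : 0 < ε) : ∃ η : ℝ, 0 < η ∧ ∀ f : C.CalF,
      ∫ t, ‖CalF.inner C f t‖ ∂haar𝕋 ≤ η → (∀ t, ‖CalF.outer C f t‖ ≤ B) → ‖C.value θ f‖ ≤ ε := by
  have hK := geomBound_pos hθ₀
  have hlim : Tendsto (fun n : ℕ => 4 * geomBound θ * (Real.exp (-(n * (1 - θ))) * B)) atTop
      (𝓝 (4 * geomBound θ * (0 * B))) := by
    refine ((Real.tendsto_exp_neg_atTop_nhds_zero.comp ?_).mul_const B).const_mul _
    exact tendsto_natCast_atTop_atTop.atTop_mul_const (by linarith)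
  rw [zero_mul, mul_zero] at hlim
  obtain ⟨n, hn⟩ := (hlim.eventually (gt_mem_nhds hε)).exists
  refine ⟨ε / (4 * geomBound θ * Real.exp (n * θ)), by positivity, fun f h₀ h₁ => ?_⟩
  refine (C.norm_value_le_of_integral_le hθ₀ (by positivity) h₀ h₁ n).trans ?_
  rw [mul_max_of_nonneg _ _ (by positivity)]
  refine max_le (le_of_eq ?_) hn.le
  field_simp

end BanachCouple

namespace BanachCouple

variable {X₀ X₁ E Y₀ Y₁ F : Type*}
  [NormedAddCommGroup X₀] [NormedSpace ℂ X₀] [CompleteSpace X₀]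
  [NormedAddCommGroup X₁] [NormedSpace ℂ X₁] [CompleteSpace X₁]
  [AddCommGroup E] [Module ℂ E] [TopologicalSpace E] [IsTopologicalAddGroup E]
  [ContinuousSMul ℂ E] [T2Space E]
  [NormedAddCommGroup Y₀] [NormedSpace ℂ Y₀] [CompleteSpace Y₀]
  [NormedAddCommGroup Y₁] [NormedSpace ℂ Y₁] [CompleteSpace Y₁]
  [AddCommGroup F] [Module ℂ F] [TopologicalSpace F] [IsTopologicalAddGroup F]
  [ContinuousSMul ℂ F] [T2Space F]

/-! ### Bounded operators between couples -/

/-- A bounded operator between Banach couples: a linear map of the sum spaces that restricts to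
bounded operators `X₀ → Y₀` and `X₁ → Y₁`. -/
structure Hom (X : BanachCouple X₀ X₁ E) (Y : BanachCouple Y₀ Y₁ F) where
  /-- the map of the sum spaces -/
  toLin : X.SumSpace →ₗ[ℂ] Y.SumSpace
  /-- the operator between the first spaces -/
  T₀ : X₀ →L[ℂ] Y₀
  /-- the operator between the second spaces -/
  T₁ : X₁ →L[ℂ] Y₁
  toLin_incl₀ : ∀ x, toLin (X.incl₀ x) = Y.incl₀ (T₀ x)
  toLin_incl₁ : ∀ x, toLin (X.incl₁ x) = Y.incl₁ (T₁ x)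

namespace Hom

variable {X : BanachCouple X₀ X₁ E} {Y : BanachCouple Y₀ Y₁ F} (S : Hom X Y)

/-- The bound `max ‖T₀‖ ‖T₁‖` of an operator between couples. -/
def bound : ℝ := max ‖S.T₀‖ ‖S.T₁‖

theorem bound_nonneg : 0 ≤ S.bound := (norm_nonneg _).trans (le_max_left _ _)

theorem norm_T₀_le (x : X₀) : ‖S.T₀ x‖ ≤ S.bound * ‖x‖ :=
  S.T₀.le_of_opNorm_le (le_max_left _ _) x

theorem norm_T₁_le (x : X₁) : ‖S.T₁ x‖ ≤ S.bound * ‖x‖ :=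
  S.T₁.le_of_opNorm_le (le_max_right _ _) x

/-- The operator on the sum spaces is bounded. -/
def mapSum : X.SumSpace →L[ℂ] Y.SumSpace :=
  S.toLin.mkContinuous S.bound fun x => by
    refine ImageSpace.le_mul_norm_of_forall_mk X.sumMap (p := fun x => ‖S.toLin x‖)
      S.bound_nonneg (fun v => ?_) x
    rw [mk_sumMap, map_add, S.toLin_incl₀, S.toLin_incl₁, WithLp.prod_norm_eq_of_L1, mul_add]
    exact (norm_add_le _ _).trans (add_le_add ((Y.norm_incl₀_le _).trans (S.norm_T₀_le _))
      ((Y.norm_incl₁_le _).trans (S.norm_T₁_le _)))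

/-- Composition with an operator between couples maps `𝓕(X)` into `𝓕(Y)`. -/
def mapCalF : X.CalF →ₗ[ℂ] Y.CalF where
  toFun f := ⟨((S.mapSum : C(X.SumSpace, Y.SumSpace)).comp (CalF.fn X f),
      (S.T₀ : C(X₀, Y₀)).comp (CalF.bdry X f).1, (S.T₁ : C(X₁, Y₁)).comp (CalF.bdry X f).2), by
    refine ⟨?_, fun w => ?_, fun w => ?_⟩
    · exact (isAnalyticInside_iff
        (g := fun z => S.mapSum (Function.extend Subtype.val (CalF.fn X f) 0 z))
        fun z => by rw [extend_closedAnnulus_apply]; rfl).2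
        (S.mapSum.differentiable.comp_differentiableOn (CalF.isAnalyticInside_fn X f))
    · have : CalF.fn X f (innerPt w) = X.incl₀ ((CalF.bdry X f).1 w) := f.2.2.1 w
      change S.toLin (CalF.fn X f (innerPt w)) = Y.incl₀ (S.T₀ ((CalF.bdry X f).1 w))
      rw [this, S.toLin_incl₀]
    · have : CalF.fn X f (outerPt w) = X.incl₁ ((CalF.bdry X f).2 w) := f.2.2.2 w
      change S.toLin (CalF.fn X f (outerPt w)) = Y.incl₁ (S.T₁ ((CalF.bdry X f).2 w))
      rw [this, S.toLin_incl₁]⟩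
  map_add' f g := by
    refine CalF.ext_boundary Y ?_ ?_ <;> ext t
    · exact map_add S.T₀ _ _
    · exact map_add S.T₁ _ _
  map_smul' c f := by
    refine CalF.ext_boundary Y ?_ ?_ <;> ext t
    · exact map_smul S.T₀ c _
    · exact map_smul S.T₁ c _

@[simp] theorem inner_mapCalF (f : X.CalF) (t : 𝕋) :
    CalF.inner Y (S.mapCalF f) t = S.T₀ (CalF.inner X f t) := rfl

@[simp] theorem outer_mapCalF (f : X.CalF) (t : 𝕋) :
    CalF.outer Y (S.mapCalF f) t = S.T₁ (CalF.outer X f t) := rfl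

theorem fn_mapCalF (f : X.CalF) (z : closedAnnulus) :
    CalF.fn Y (S.mapCalF f) z = S.toLin (CalF.fn X f z) := rfl

theorem norm_mapCalF_le (f : X.CalF) : ‖S.mapCalF f‖ ≤ S.bound * ‖f‖ :=
  CalF.norm_le_of_boundary Y
    (fun t => (S.norm_T₀_le _).trans
      (mul_le_mul_of_nonneg_left (CalF.norm_inner_le X f t) S.bound_nonneg))
    (fun t => (S.norm_T₁_le _).trans
      (mul_le_mul_of_nonneg_left (CalF.norm_outer_le X f t) S.bound_nonneg))

variable (θ : Set.Icc (0 : ℝ) 1)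

theorem ker_evalAt_le : LinearMap.ker (X.evalAt θ : X.CalF →ₗ[ℂ] X.SumSpace) ≤
    LinearMap.ker (Y.value θ ∘ₗ S.mapCalF) := fun f hf => by
  have hf' : CalF.fn X f (expPt θ) = 0 := hf
  refine ImageSpace.val_injective (Y.evalAt θ) ?_
  change CalF.fn Y (S.mapCalF f) (expPt θ) = 0
  rw [fn_mapCalF, hf', map_zero]

/-- The operator between the interpolation spaces as a linear map. -/
def mapInterpLin : X.Interp θ →ₗ[ℂ] Y.Interp θ :=
  (Submodule.liftQ (LinearMap.ker (X.evalAt θ : X.CalF →ₗ[ℂ] X.SumSpace))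
    (Y.value θ ∘ₗ S.mapCalF) (S.ker_evalAt_le θ)) ∘ₗ (ImageSpace.toQuot (X.evalAt θ)).toLinearMap

theorem mapInterpLin_value (f : X.CalF) :
    S.mapInterpLin θ (X.value θ f) = Y.value θ (S.mapCalF f) := by
  change Submodule.liftQ _ _ (S.ker_evalAt_le θ)
    (ImageSpace.toQuot (X.evalAt θ) (ImageSpace.mk (X.evalAt θ) f)) = _
  rw [ImageSpace.toQuot_mk]
  rfl

/-- The operator between the interpolation spaces. -/
def mapInterp : X.Interp θ →L[ℂ] Y.Interp θ :=
  (S.mapInterpLin θ).mkContinuous S.bound fun x => by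
    refine ImageSpace.le_mul_norm_of_forall_mk (X.evalAt θ) (p := fun x => ‖S.mapInterpLin θ x‖)
      S.bound_nonneg (fun f => ?_) x
    exact (congrArg norm (S.mapInterpLin_value θ f)).trans_le
      ((Y.norm_value_le θ _).trans (S.norm_mapCalF_le f))

theorem mapInterp_value (f : X.CalF) :
    S.mapInterp θ (X.value θ f) = Y.value θ (S.mapCalF f) := S.mapInterpLin_value θ f

theorem interpVal_mapInterp (x : X.Interp θ) :
    Y.interpVal θ (S.mapInterp θ x) = S.toLin (X.interpVal θ x) := by
  obtain ⟨f, rfl⟩ := ImageSpace.mk_surjective (X.evalAt θ) x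
  exact congrArg (Y.interpVal θ) (S.mapInterp_value θ f)

/-! ### Means of truncated Laurent polynomials on the inner circle -/

/-- The mean over the inner circle of the norm in `Y₀` of the image of a Laurent polynomial. -/
def innerMean (b : ℤ →₀ X.inter) : ℝ := ∫ t, ‖S.T₀ (trig (CalF.innerCoeff X b) t)‖ ∂haar𝕋

theorem integrable_innerMean (b : ℤ →₀ X.inter) :
    Integrable (fun t => ‖S.T₀ (trig (CalF.innerCoeff X b) t)‖) haar𝕋 :=
  (integrable_continuousMap ((S.T₀ : C(X₀, Y₀)).comp (trig (CalF.innerCoeff X b)))).norm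

theorem innerMean_add_le (b c : ℤ →₀ X.inter) :
    S.innerMean (b + c) ≤ S.innerMean b + S.innerMean c := by
  rw [innerMean, innerMean, innerMean,
    ← integral_add (S.integrable_innerMean b) (S.integrable_innerMean c)]
  refine integral_mono (S.integrable_innerMean _)
    ((S.integrable_innerMean b).add (S.integrable_innerMean c)) fun t => ?_
  simp only [map_add, ContinuousMap.add_apply]
  exact norm_add_le _ _

theorem innerMean_le_of_forall {b : ℤ →₀ X.inter} {M : ℝ}
    (h : ∀ t, ‖S.T₀ (trig (CalF.innerCoeff X b) t)‖ ≤ M) : S.innerMean b ≤ M := by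
  refine (integral_mono (S.integrable_innerMean b) (integrable_const M) h).trans ?_
  simp

end Hom

theorem CalF.innerCoeff_filter (X : BanachCouple X₀ X₁ E) (b : ℤ →₀ X.inter) (p : ℤ → Prop)
    [DecidablePred p] :
    CalF.innerCoeff X (b.filter p) = (CalF.innerCoeff X b).filter p := by
  ext k
  rw [CalF.innerCoeff_apply, Finsupp.filter_apply, Finsupp.filter_apply]
  split_ifs <;> simp

namespace Hom

variable {X : BanachCouple X₀ X₁ E} {Y : BanachCouple Y₀ Y₁ F} (S : Hom X Y)

theorem toLin_incl_interFst (x : X.inter) :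
    Y.incl₀ (S.T₀ (X.interFst x)) = Y.incl₁ (S.T₁ (X.interSnd x)) := by
  rw [← S.toLin_incl₀, ← S.toLin_incl₁, X.incl₀_interFst]

theorem norm_interSnd_le_of_outer {b : ℤ →₀ X.inter} {M : ℝ}
    (h : ∀ t, ‖trig (CalF.outerCoeff X b) t‖ ≤ M) (k : ℤ) :
    ‖X.interSnd (b k)‖ ≤ M * Real.exp (-k) := by
  have h1 := norm_coeff_le_of_trig h k
  rw [CalF.outerCoeff_apply, norm_smul, Complex.norm_real,
    Real.norm_of_nonneg (Real.exp_pos _).le] at h1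
  rw [Real.exp_neg, ← div_eq_mul_inv, le_div_iff₀ (Real.exp_pos _), mul_comm]
  exact h1

/-- High positive frequencies are small on the inner circle: the bound on the outer circle makes
their coefficients exponentially small in `X₁`, hence their images are small in `Y₀ + Y₁`, and by
compactness in the mean in `Y₀`. -/
theorem exists_innerMean_filter_ge_le (hX₀ : IsUMD X₀) (hS : IsCompactOperator S.T₀) {M η : ℝ}
    (hM : 0 ≤ M) (hη : 0 < η) : ∃ N₀ : ℕ, ∀ N : ℕ, N₀ ≤ N → ∀ b : ℤ →₀ X.inter,
      (∀ t, ‖trig (CalF.innerCoeff X b) t‖ ≤ M) → (∀ t, ‖trig (CalF.outerCoeff X b) t‖ ≤ M) →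
      S.innerMean (b.filter ((N : ℤ) ≤ ·)) ≤ η := by
  obtain ⟨U, hU, hUMD⟩ := hX₀.exists_bound
  obtain ⟨K, hK, hE⟩ := hS.exists_norm_le_add_norm_comp (q := Y.inclCLM₀) Y.incl₀_injective
    (δ := η / (2 * (U * M + 1))) (by positivity)
  have hlim : Tendsto (fun N : ℕ => K * (S.bound * M * (Real.exp (-(N : ℝ)) * geomBound 1))) atTop
      (𝓝 (K * (S.bound * M * (0 * geomBound 1)))) :=
    (((Real.tendsto_exp_neg_atTop_nhds_zero.comp tendsto_natCast_atTop_atTop).mul_const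
      _).const_mul _).const_mul _
  rw [zero_mul, mul_zero, mul_zero] at hlim
  obtain ⟨N₀, hN₀⟩ := eventually_atTop.1 (hlim.eventually (gt_mem_nhds (half_pos hη)))
  refine ⟨N₀, fun N hN b h₀ h₁ => ?_⟩
  set c := b.filter ((N : ℤ) ≤ ·) with hc
  have hcoef : ∀ t, ‖Y.inclCLM₀ (S.T₀ (trig (CalF.innerCoeff X c) t))‖ ≤
      S.bound * M * (Real.exp (-(N : ℝ)) * geomBound 1) := by
    intro t
    have e1 : Y.inclCLM₀ (S.T₀ (trig (CalF.innerCoeff X c) t)) =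
        trig (Finsupp.mapRange.linearMap ((Y.inclCLM₁.comp S.T₁).comp X.interSnd).toLinearMap c)
          t := by
      rw [trig_mapRange, CalF.innerCoeff, trig_mapRange]
      exact S.toLin_incl_interFst _
    rw [e1]
    refine (norm_trig_apply_le _ t).trans ?_
    rw [Finsupp.mapRange.linearMap_apply, Finsupp.sum_mapRange_index (by simp)]
    calc c.sum (fun _ x => ‖((Y.inclCLM₁.comp S.T₁).comp X.interSnd) x‖)
        ≤ ∑ k ∈ c.support, S.bound * M * Real.exp (-(1 * k)) := by
          refine Finset.sum_le_sum fun k hk => ?_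
          rw [hc, Finsupp.support_filter, Finset.mem_filter] at hk
          rw [hc, Finsupp.filter_apply_pos _ _ hk.2, one_mul, mul_assoc]
          refine (Y.norm_incl₁_le _).trans ((S.norm_T₁_le _).trans ?_)
          exact mul_le_mul_of_nonneg_left (norm_interSnd_le_of_outer h₁ k) S.bound_nonneg
      _ ≤ S.bound * M * (Real.exp (-(N : ℝ)) * geomBound 1) := by
          rw [← Finset.mul_sum]
          refine mul_le_mul_of_nonneg_left ?_ (mul_nonneg S.bound_nonneg hM)
          have := sum_exp_le_of_ge one_pos c.support (M := N) fun k hk => by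
            rw [hc, Finsupp.support_filter, Finset.mem_filter] at hk
            exact hk.2
          simpa using this
  have hmean : ∫ t, ‖trig (CalF.innerCoeff X c) t‖ ∂haar𝕋 ≤ U * M := by
    refine (integral_norm_le_normLTwo _).trans ?_
    rw [hc, CalF.innerCoeff_filter]
    exact (hUMD _ _).trans (mul_le_mul_of_nonneg_left (normLTwo_le h₀) hU)
  have hi := (integrable_continuousMap (trig (CalF.innerCoeff X c))).norm
  calc S.innerMean c ≤ ∫ t, (η / (2 * (U * M + 1)) * ‖trig (CalF.innerCoeff X c) t‖ +
        K * (S.bound * M * (Real.exp (-(N : ℝ)) * geomBound 1))) ∂haar𝕋 := by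
        refine integral_mono (S.integrable_innerMean c) ((hi.const_mul _).add
          (integrable_const _)) fun t => ?_
        exact (hE _).trans (add_le_add_right (mul_le_mul_of_nonneg_left (hcoef t) hK) _)
    _ = η / (2 * (U * M + 1)) * ∫ t, ‖trig (CalF.innerCoeff X c) t‖ ∂haar𝕋 +
        K * (S.bound * M * (Real.exp (-(N : ℝ)) * geomBound 1)) := by
        rw [integral_add (hi.const_mul _) (integrable_const _), integral_const_mul]
        simp
    _ ≤ η / (2 * (U * M + 1)) * (U * M) + η / 2 := by
        gcongr
        exact (hN₀ N hN).le
    _ ≤ η := by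
        have : η / (2 * (U * M + 1)) * (U * M) ≤ η / 2 := by
          rw [div_mul_eq_mul_div, div_le_div_iff₀ (by positivity) two_pos]
          nlinarith [mul_nonneg hU hM]
        linarith

/-- Negative frequencies can be corrected on the inner circle by a Laurent polynomial with
coefficients from a bounded subset of `X₀ ∩ X₁`: the correction `u` is built from a partition of
unity and a finite net of the image under `T₀`, so that `b - u` is bounded in `X₀` and has small
image in `Y₀`. The truncation is controlled by the UMD property, together with the
finitely many functionals which compute the norm of `T₀ x` up to a small multiple of `‖x‖`. -/
theorem exists_correction (hX₀ : IsUMD X₀) (hS : IsCompactOperator S.T₀) {M η : ℝ}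
    (hM : 0 ≤ M) (hη : 0 < η) : ∃ R : ℝ, 0 ≤ R ∧ ∀ b : ℤ →₀ X.inter,
      (∀ t, ‖trig (CalF.innerCoeff X b) t‖ ≤ M) → ∃ u : ℤ →₀ X.inter, (∀ k, ‖u k‖ ≤ R) ∧
      ∀ N : ℤ, S.innerMean ((b - u).filter (· < N)) ≤ η := by
  obtain ⟨U, hU, hUMD⟩ := hX₀.exists_bound
  obtain ⟨L, hL⟩ := hS.exists_norm_le_add_sum_dual
    (δ := η / (2 * ((U + 1) * (2 * M + 1)))) (by positivity)
  obtain ⟨ε, hε, hεL⟩ : ∃ ε : ℝ, 0 < ε ∧ ∑ l ∈ L, ‖l‖ * (2 * ε) ≤ η / 2 := by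
    have h0 : 0 ≤ ∑ l ∈ L, ‖l‖ := Finset.sum_nonneg fun _ _ => norm_nonneg _
    refine ⟨η / (4 * (∑ l ∈ L, ‖l‖ + 1)), by positivity, ?_⟩
    rw [← Finset.sum_mul, mul_div_assoc', mul_div_assoc', div_le_div_iff₀ (by positivity) two_pos]
    nlinarith
  let A : Set Y₀ := (fun x : X.inter => S.T₀ (X.interFst x)) '' {x | ‖X.interFst x‖ ≤ M}
  have hA : TotallyBounded A := by
    refine ((IsCompactOperator.isCompact_closure_image_closedBall (f := S.T₀.toLinearMap) hS
      M).totallyBounded).subset ?_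
    rintro _ ⟨x, hx, rfl⟩
    exact subset_closure ⟨X.interFst x, by simpa using hx, rfl⟩
  obtain ⟨s, hsA, hsf, hcov⟩ := hA.exists_subset (Metric.dist_mem_uniformity hε)
  have := hsf.fintype
  choose x hxM hx using fun y : s => hsA y.2
  let Sx : ℝ := ∑ j, (‖x j‖ + ‖S.T₀ (X.interFst (x j))‖)
  have hSx : 0 ≤ Sx := Finset.sum_nonneg fun j _ => by positivity
  refine ⟨∑ j, 2 * ‖x j‖, Finset.sum_nonneg fun j _ => by positivity, fun b hb => ?_⟩
  have hmem : ∀ t, ∃ j, ‖S.T₀ (trig (CalF.innerCoeff X b) t) - S.T₀ (X.interFst (x j))‖ < ε := by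
    intro t
    have e1 : trig (CalF.innerCoeff X b) t = X.interFst (trig b t) := trig_mapRange X.interFst b t
    have e2 : S.T₀ (trig (CalF.innerCoeff X b) t) ∈ A :=
      ⟨trig b t, by rw [Set.mem_ofPred_eq, ← e1]; exact hb t, by rw [e1]⟩
    obtain ⟨y, hy, hd⟩ := Set.mem_iUnion₂.1 (hcov e2)
    refine ⟨⟨y, hy⟩, ?_⟩
    have e3 := hx ⟨y, hy⟩
    simp only at e3
    rw [e3, ← dist_eq_norm]
    exact hd
  obtain ⟨ρ, φ, hρ0, hρ1, hρq, hφ⟩ := exists_trig_partition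
    ((S.T₀ : C(X₀, Y₀)).comp (trig (CalF.innerCoeff X b))) (fun j => S.T₀ (X.interFst (x j)))
    (η := min 1 ε / (Sx + 1)) (by positivity) hmem
  set err := min 1 ε / (Sx + 1) with herr
  have herr0 : 0 ≤ err := by positivity
  have herr1 : err ≤ 1 := (div_le_one (by positivity)).2 ((min_le_left _ _).trans (by linarith))
  have herrS : err * Sx ≤ min 1 ε := by
    rw [herr, div_mul_eq_mul_div, div_le_iff₀ (by positivity)]
    have : 0 < min 1 ε := by positivity
    nlinarith
  let u : ℤ →₀ X.inter := ∑ j, Finsupp.mapRange.linearMap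
    (ContinuousLinearMap.toSpanSingleton ℂ (x j)).toLinearMap (φ j)
  have hu : ∀ t, trig (CalF.innerCoeff X u) t = ∑ j, trig (φ j) t • X.interFst (x j) := by
    intro t
    rw [CalF.innerCoeff, trig_mapRange]
    simp only [u, map_sum, ContinuousMap.sum_apply, trig_mapRange,
      ContinuousLinearMap.toSpanSingleton_apply, map_smul]
  have hφ2 : ∀ j t, ‖trig (φ j) t‖ ≤ 2 := fun j t => by
    have h1 : ‖trig (φ j) t‖ ≤ ‖trig (φ j) t - ρ j t‖ + ‖(ρ j t : ℂ)‖ := by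
      simpa using norm_add_le (trig (φ j) t - ρ j t) (ρ j t : ℂ)
    rw [Complex.norm_real, Real.norm_of_nonneg (hρ0 j t)] at h1
    have h2 : ρ j t ≤ 1 := by
      rw [← hρ1 t]
      exact Finset.single_le_sum (f := fun j => ρ j t) (fun i _ => hρ0 i t) (Finset.mem_univ j)
    linarith [hφ j t]
  refine ⟨u, fun k => ?_, fun N => ?_⟩
  · have : u k = ∑ j, φ j k • x j := by
      simp [u, Finsupp.finsetSum_apply]
    rw [this]
    refine (norm_sum_le _ _).trans (Finset.sum_le_sum fun j _ => ?_)
    rw [norm_smul]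
    exact mul_le_mul_of_nonneg_right (norm_coeff_le_of_trig (hφ2 j) k) (norm_nonneg _)
  -- `h` is bounded in `X₀` and has small image in `Y₀`, independently of the net and of `b`
  set h := b - u with hh
  have hht : ∀ t, trig (CalF.innerCoeff X h) t =
      (trig (CalF.innerCoeff X b) t - ∑ j, (ρ j t : ℂ) • X.interFst (x j)) -
        ∑ j, (trig (φ j) t - ρ j t) • X.interFst (x j) := by
    intro t
    rw [hh, map_sub (CalF.innerCoeff X) b u, map_sub, ContinuousMap.sub_apply, hu]
    simp only [sub_smul, Finset.sum_sub_distrib]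
    abel
  have hhM : ∀ t, ‖trig (CalF.innerCoeff X h) t‖ ≤ 2 * M + 1 := by
    intro t
    rw [hht]
    have h1 : ‖∑ j, (ρ j t : ℂ) • X.interFst (x j)‖ ≤ M := by
      calc ‖∑ j, (ρ j t : ℂ) • X.interFst (x j)‖ ≤ ∑ j, ρ j t * M := by
            refine (norm_sum_le _ _).trans (Finset.sum_le_sum fun j _ => ?_)
            rw [norm_smul, Complex.norm_real, Real.norm_of_nonneg (hρ0 j t)]
            exact mul_le_mul_of_nonneg_left (hxM j) (hρ0 j t)
        _ = M := by rw [← Finset.sum_mul, hρ1, one_mul]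
    have h2 : ‖∑ j, (trig (φ j) t - ρ j t) • X.interFst (x j)‖ ≤ 1 := by
      calc ‖∑ j, (trig (φ j) t - ρ j t) • X.interFst (x j)‖
          ≤ ∑ j, err * (‖x j‖ + ‖S.T₀ (X.interFst (x j))‖) := by
            refine (norm_sum_le _ _).trans (Finset.sum_le_sum fun j _ => ?_)
            rw [norm_smul]
            exact mul_le_mul (hφ j t) ((X.norm_interFst_le _).trans
              (le_add_of_nonneg_right (norm_nonneg _))) (norm_nonneg _) herr0
        _ ≤ 1 := by rw [← Finset.mul_sum]; exact herrS.trans (min_le_left _ _)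
    have h3 := hb t
    refine (norm_sub_le _ _).trans ?_
    have h4 := norm_sub_le (trig (CalF.innerCoeff X b) t) (∑ j, (ρ j t : ℂ) • X.interFst (x j))
    linarith
  have hhε : ∀ t, ‖S.T₀ (trig (CalF.innerCoeff X h) t)‖ ≤ 2 * ε := by
    intro t
    rw [hht, map_sub, map_sub]
    simp only [map_sum, map_smul]
    have h2 : ‖∑ j, (trig (φ j) t - ρ j t) • S.T₀ (X.interFst (x j))‖ ≤ ε := by
      calc ‖∑ j, (trig (φ j) t - ρ j t) • S.T₀ (X.interFst (x j))‖
          ≤ ∑ j, err * (‖x j‖ + ‖S.T₀ (X.interFst (x j))‖) := by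
            refine (norm_sum_le _ _).trans (Finset.sum_le_sum fun j _ => ?_)
            rw [norm_smul]
            exact mul_le_mul (hφ j t) (le_add_of_nonneg_left (norm_nonneg _)) (norm_nonneg _)
              herr0
        _ ≤ ε := by rw [← Finset.mul_sum]; exact herrS.trans (min_le_right _ _)
    have h1 := hρq t
    simp only [ContinuousMap.comp_apply, ContinuousMap.coe_coe] at h1
    refine (norm_sub_le _ _).trans ?_
    linarith
  have hL2 : normLTwo (trig ((CalF.innerCoeff X h).filter (· < N))) ≤ (U + 1) * (2 * M + 1) := by
    rw [trig_filter_lt]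
    refine (normLTwo_sub_le _ _).trans ?_
    have h1 := normLTwo_le hhM
    have h2 := hUMD N (CalF.innerCoeff X h)
    nlinarith
  have hl : ∀ l : Y₀ →L[ℂ] ℂ,
      ∫ t, ‖l (S.T₀ (trig ((CalF.innerCoeff X h).filter (· < N)) t))‖ ∂haar𝕋 ≤ ‖l‖ * (2 * ε) := by
    intro l
    have e1 : ∀ a : ℤ →₀ X₀, ∀ t, l (S.T₀ (trig a t)) =
        trig (Finsupp.mapRange.linearMap (l.comp S.T₀).toLinearMap a) t := fun a t => by
      rw [trig_mapRange]; rfl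
    have e2 : Finsupp.mapRange.linearMap (l.comp S.T₀).toLinearMap
        ((CalF.innerCoeff X h).filter (· < N)) = (Finsupp.mapRange.linearMap
          (l.comp S.T₀).toLinearMap (CalF.innerCoeff X h)).filter (· < N) := by
      ext k
      simp only [Finsupp.mapRange.linearMap_apply, Finsupp.mapRange_apply, Finsupp.filter_apply]
      split_ifs <;> simp
    simp only [e1, e2]
    refine (integral_norm_le_normLTwo _).trans ((normLTwo_filter_le _ _).trans
      (normLTwo_le fun t => ?_))
    rw [← e1]
    exact (l.le_opNorm _).trans (mul_le_mul_of_nonneg_left (hhε t) (norm_nonneg _))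
  have hi := (integrable_continuousMap (trig ((CalF.innerCoeff X h).filter (· < N)))).norm
  have hil : ∀ l : Y₀ →L[ℂ] ℂ, Integrable
      (fun t => ‖l (S.T₀ (trig ((CalF.innerCoeff X h).filter (· < N)) t))‖) haar𝕋 := fun l =>
    (integrable_continuousMap ((l.comp S.T₀ : C(X₀, ℂ)).comp
      (trig ((CalF.innerCoeff X h).filter (· < N))))).norm
  calc S.innerMean (h.filter (· < N))
      ≤ ∫ t, (η / (2 * ((U + 1) * (2 * M + 1))) *
          ‖trig ((CalF.innerCoeff X h).filter (· < N)) t‖ +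
          ∑ l ∈ L, ‖l (S.T₀ (trig ((CalF.innerCoeff X h).filter (· < N)) t))‖) ∂haar𝕋 := by
        refine integral_mono (S.integrable_innerMean _) ((hi.const_mul _).add
          (integrable_finsetSum _ fun l _ => hil l)) fun t => ?_
        simp only [CalF.innerCoeff_filter]
        exact hL _
    _ = η / (2 * ((U + 1) * (2 * M + 1))) *
          ∫ t, ‖trig ((CalF.innerCoeff X h).filter (· < N)) t‖ ∂haar𝕋 +
        ∑ l ∈ L, ∫ t, ‖l (S.T₀ (trig ((CalF.innerCoeff X h).filter (· < N)) t))‖ ∂haar𝕋 := by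
        rw [integral_add (hi.const_mul _) (integrable_finsetSum _ fun l _ => hil l),
          integral_const_mul, integral_finsetSum _ fun l _ => hil l]
    _ ≤ η / (2 * ((U + 1) * (2 * M + 1))) * ((U + 1) * (2 * M + 1)) + η / 2 := by
        refine add_le_add (mul_le_mul_of_nonneg_left
          ((integral_norm_le_normLTwo _).trans hL2) (by positivity))
          ((Finset.sum_le_sum fun l _ => hl l).trans hεL)
    _ = η := by field_simp; ring

end Hom
end BanachCouple

namespace BanachCouple

variable {X₀ X₁ E Y₀ Y₁ F : Type*}
  [NormedAddCommGroup X₀] [NormedSpace ℂ X₀] [CompleteSpace X₀]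
  [NormedAddCommGroup X₁] [NormedSpace ℂ X₁] [CompleteSpace X₁]
  [AddCommGroup E] [Module ℂ E] [TopologicalSpace E] [IsTopologicalAddGroup E]
  [ContinuousSMul ℂ E] [T2Space E]
  [NormedAddCommGroup Y₀] [NormedSpace ℂ Y₀] [CompleteSpace Y₀]
  [NormedAddCommGroup Y₁] [NormedSpace ℂ Y₁] [CompleteSpace Y₁]
  [AddCommGroup F] [Module ℂ F] [TopologicalSpace F] [IsTopologicalAddGroup F]
  [ContinuousSMul ℂ F] [T2Space F]

/-! ### Laurent coefficients as operators, and averages of Laurent polynomials -/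

namespace CalF

variable (X : BanachCouple X₀ X₁ E)

theorem norm_coeff_le (f : X.CalF) (k : ℤ) : ‖coeff X f k‖ ≤ max 1 (Real.exp (-k)) * ‖f‖ := by
  refine max_le ?_ ?_
  · refine (norm_fourierCoeff_le (norm_inner_le X f) k).trans ?_
    exact le_mul_of_one_le_left (norm_nonneg _) (le_max_left _ _)
  · change ‖((Real.exp (-k) : ℝ) : ℂ) • fourierCoeff (outer X f) k‖ ≤ _
    rw [norm_smul, Complex.norm_real, Real.norm_of_nonneg (Real.exp_pos _).le]
    exact mul_le_mul (le_max_right _ _) (norm_fourierCoeff_le (norm_outer_le X f) k)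
      (norm_nonneg _) (le_max_of_le_left zero_le_one)

/-- The `k`-th Laurent coefficient as a bounded operator from `𝓕` to `X₀ ∩ X₁`. -/
def coeffCLM (k : ℤ) : X.CalF →L[ℂ] X.inter :=
  LinearMap.mkContinuous
    { toFun := fun f => coeff X f k
      map_add' := fun f g => by
        refine Subtype.ext (Prod.ext ?_ ?_)
        · change fourierCoeff (inner X (f + g)) k =
            fourierCoeff (inner X f) k + fourierCoeff (inner X g) k
          rw [map_add, ContinuousMap.coe_add, fourierCoeff.add (integrable_continuousMap _)
            (integrable_continuousMap _), Pi.add_apply]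
        · change _ • fourierCoeff (outer X (f + g)) k =
            _ • fourierCoeff (outer X f) k + _ • fourierCoeff (outer X g) k
          rw [map_add, ContinuousMap.coe_add, fourierCoeff.add (integrable_continuousMap _)
            (integrable_continuousMap _), Pi.add_apply, smul_add]
      map_smul' := fun c f => by
        refine Subtype.ext (Prod.ext ?_ ?_)
        · change fourierCoeff (inner X (c • f)) k = c • fourierCoeff (inner X f) k
          rw [map_smul, ContinuousMap.coe_smul, fourierCoeff.const_smul]
        · change _ • fourierCoeff (outer X (c • f)) k = c • _ • fourierCoeff (outer X f) k
          rw [map_smul, ContinuousMap.coe_smul, fourierCoeff.const_smul, smul_comm] }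
    (max 1 (Real.exp (-k))) fun f => norm_coeff_le X f k

@[simp] theorem coeffCLM_apply (k : ℤ) (f : X.CalF) : coeffCLM X k f = coeff X f k := rfl

theorem coeff_laurent (a : ℤ →₀ X.inter) (k : ℤ) : coeff X (laurent X a) k = a k := by
  refine Subtype.ext (Prod.ext ?_ ?_)
  · change fourierCoeff (inner X (laurent X a)) k = X.interFst (a k)
    rw [inner_laurent, fourierCoeff_trig, innerCoeff_apply]
  · change ((Real.exp (-k) : ℝ) : ℂ) • fourierCoeff (outer X (laurent X a)) k = X.interSnd (a k)
    rw [outer_laurent, fourierCoeff_trig, outerCoeff_apply, smul_smul, ← Complex.ofReal_mul,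
      ← Real.exp_add, neg_add_cancel, Real.exp_zero, Complex.ofReal_one, one_smul]

theorem norm_trig_innerCoeff_coeffMul_le {a : ℤ →₀ X.inter} {M : ℝ}
    (h : ∀ t, ‖trig (innerCoeff X a) t‖ ≤ M) (n : ℕ) (t : 𝕋) :
    ‖trig (innerCoeff X (coeffMul (kernelCoeff n) a)) t‖ ≤ M := by
  have : innerCoeff X (coeffMul (kernelCoeff n) a) =
      coeffMul (kernelCoeff n) (innerCoeff X a) := by ext k; simp
  rw [this, ← kernelMean_trig]
  exact norm_kernelMean_apply_le h t

theorem norm_trig_outerCoeff_coeffMul_le {a : ℤ →₀ X.inter} {M : ℝ}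
    (h : ∀ t, ‖trig (outerCoeff X a) t‖ ≤ M) (n : ℕ) (t : 𝕋) :
    ‖trig (outerCoeff X (coeffMul (kernelCoeff n) a)) t‖ ≤ M := by
  have : outerCoeff X (coeffMul (kernelCoeff n) a) =
      coeffMul (kernelCoeff n) (outerCoeff X a) := by
    ext k
    simp only [outerCoeff_apply, coeffMul_apply, map_smul]
    rw [smul_comm]
  rw [this, ← kernelMean_trig]
  exact norm_kernelMean_apply_le h t

end CalF

namespace Hom

variable {X : BanachCouple X₀ X₁ E} {Y : BanachCouple Y₀ Y₁ F} (S : Hom X Y)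

/-! ### Compactness on constants -/

theorem norm_mapInterp_le (θ : Set.Icc (0 : ℝ) 1) (x : X.Interp θ) :
    ‖S.mapInterp θ x‖ ≤ S.bound * ‖x‖ :=
  (S.mapInterp θ).le_of_opNorm_le (LinearMap.mkContinuous_norm_le _ S.bound_nonneg _) x

/-- The operator `X₀ ∩ X₁ → [Y₀, Y₁]_θ`. -/
def mapConst (θ : Set.Icc (0 : ℝ) 1) : X.inter →L[ℂ] Y.Interp θ :=
  ((S.mapInterp θ).toLinearMap ∘ₗ X.value θ ∘ₗ CalF.const X).mkContinuous S.bound fun x =>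
    (S.norm_mapInterp_le θ _).trans
      (mul_le_mul_of_nonneg_left (X.norm_value_const_le θ x) S.bound_nonneg)

theorem mapConst_apply (θ : Set.Icc (0 : ℝ) 1) (x : X.inter) :
    S.mapConst θ x = S.mapInterp θ (X.value θ (CalF.const X x)) := rfl

theorem isCompactOperator_mapConst {θ : Set.Icc (0 : ℝ) 1} (hθ₀ : 0 < (θ : ℝ))
    (hθ₁ : (θ : ℝ) < 1) (hS : IsCompactOperator S.T₀) : IsCompactOperator (S.mapConst θ) := by
  refine (isCompactOperator_iff_isCompact_closure_image_closedBall
    (S.mapConst θ).toLinearMap one_pos).2 ?_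
  refine TotallyBounded.isCompact_of_isClosed (TotallyBounded.closure ?_) isClosed_closure
  rw [Metric.totallyBounded_iff]
  intro ε hε
  obtain ⟨η, hη, hval⟩ := Y.exists_norm_value_le hθ₀ hθ₁ (S.bound * 2) (half_pos hε)
  let A : Set Y₀ := (fun x : X.inter => S.T₀ (X.interFst x)) '' Metric.closedBall 0 1
  have hA : TotallyBounded A := by
    refine ((IsCompactOperator.isCompact_closure_image_closedBall (f := S.T₀.toLinearMap) hS
      1).totallyBounded).subset ?_
    rintro _ ⟨x, hx, rfl⟩
    rw [mem_closedBall_zero_iff] at hx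
    exact subset_closure ⟨X.interFst x, by simpa using (X.norm_interFst_le x).trans hx, rfl⟩
  obtain ⟨s, hsA, hsf, hcov⟩ := hA.exists_subset (Metric.dist_mem_uniformity hη)
  have := hsf.fintype
  choose x hx1 hx using fun y : s => hsA y.2
  refine ⟨Set.range fun j => S.mapConst θ (x j), Set.finite_range _, ?_⟩
  rintro _ ⟨z, hz, rfl⟩
  rw [mem_closedBall_zero_iff] at hz
  obtain ⟨y, hy, hd⟩ := Set.mem_iUnion₂.1 (hcov ⟨z, by simpa using hz, rfl⟩)
  refine Set.mem_iUnion₂.2 ⟨_, ⟨⟨y, hy⟩, rfl⟩, ?_⟩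
  have e1 := hx ⟨y, hy⟩
  have e2 := hx1 ⟨y, hy⟩
  rw [mem_closedBall_zero_iff] at e2
  simp only at e1
  rw [Metric.mem_ball, dist_eq_norm]
  change ‖S.mapConst θ z - S.mapConst θ (x ⟨y, hy⟩)‖ < ε
  generalize x ⟨y, hy⟩ = x' at e1 e2 ⊢
  rw [← map_sub, mapConst_apply, mapInterp_value]
  refine (hval _ ?_ fun t => ?_).trans_lt (half_lt_self hε)
  · have e3 : ∀ t, CalF.inner Y (S.mapCalF (CalF.const X (z - x'))) t =
        S.T₀ (X.interFst z) - y := fun t => by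
      rw [← e1, ← map_sub, ← map_sub]; rfl
    have e4 : ‖S.T₀ (X.interFst z) - y‖ < η := by rw [← dist_eq_norm]; exact hd
    simp only [e3]
    simpa using e4.le
  · refine (S.norm_T₁_le _).trans (mul_le_mul_of_nonneg_left ?_ S.bound_nonneg)
    change ‖X.interSnd (z - x')‖ ≤ 2
    refine (X.norm_interSnd_le _).trans ((norm_sub_le _ _).trans ?_)
    linarith

/-! ### Compactness on the interpolation space -/

theorem norm_mapInterp_value_laurent_le {θ : Set.Icc (0 : ℝ) 1} (hθ₀ : 0 < (θ : ℝ))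
    {v : ℤ →₀ X.inter} {R : ℝ} (hR : ∀ k, ‖v k‖ ≤ R) {M : ℤ} (hM : ∀ k ∈ v.support, k ≤ M) :
    ‖S.mapInterp θ (X.value θ (CalF.laurent X v))‖ ≤
      S.bound * (R * (Real.exp (θ * M) * geomBound θ)) := by
  have hR0 : 0 ≤ R := (norm_nonneg _).trans (hR 0)
  refine (S.norm_mapInterp_le θ _).trans (mul_le_mul_of_nonneg_left ?_ S.bound_nonneg)
  rw [value_laurent]
  calc ‖v.sum fun k x => ((Real.exp (θ * k) : ℝ) : ℂ) • X.value θ (CalF.const X x)‖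
      ≤ ∑ k ∈ v.support, R * Real.exp (θ * k) := by
        refine (norm_sum_le _ _).trans (Finset.sum_le_sum fun k _ => ?_)
        rw [norm_smul, Complex.norm_real, Real.norm_of_nonneg (Real.exp_pos _).le, mul_comm]
        exact mul_le_mul_of_nonneg_right ((X.norm_value_const_le θ _).trans (hR k))
          (Real.exp_pos _).le
    _ ≤ R * (Real.exp (θ * M) * geomBound θ) := by
        rw [← Finset.mul_sum]
        exact mul_le_mul_of_nonneg_left (sum_exp_le_of_le hθ₀ _ hM) hR0

theorem norm_trig_outerCoeff_le {v : ℤ →₀ X.inter} {R : ℝ} (hR : ∀ k, ‖v k‖ ≤ R) {M : ℤ}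
    (hM : ∀ k ∈ v.support, k ≤ M) (t : 𝕋) :
    ‖trig (CalF.outerCoeff X v) t‖ ≤ R * (Real.exp M * geomBound 1) := by
  have hR0 : 0 ≤ R := (norm_nonneg _).trans (hR 0)
  have hsub : (CalF.outerCoeff X v).support ⊆ v.support := fun k hk => by
    rw [Finsupp.mem_support_iff] at hk ⊢
    rintro h
    exact hk (by rw [CalF.outerCoeff_apply, h, map_zero, smul_zero])
  refine (norm_trig_apply_le _ t).trans ?_
  rw [Finsupp.sum_of_support_subset _ hsub _ (by simp)]
  calc ∑ k ∈ v.support, ‖CalF.outerCoeff X v k‖ ≤ ∑ k ∈ v.support, R * Real.exp (1 * k) := by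
        refine Finset.sum_le_sum fun k _ => ?_
        rw [CalF.outerCoeff_apply, norm_smul, Complex.norm_real,
          Real.norm_of_nonneg (Real.exp_pos _).le, one_mul, mul_comm]
        exact mul_le_mul_of_nonneg_right ((X.norm_interSnd_le _).trans (hR k)) (Real.exp_pos _).le
    _ ≤ R * (Real.exp M * geomBound 1) := by
        rw [← Finset.mul_sum]
        have := sum_exp_le_of_le one_pos _ hM
        rw [one_mul] at this
        exact mul_le_mul_of_nonneg_left this hR0

/-- On Laurent polynomials, averaging over rotations with a good kernel changes the image of the
value at `e ^ θ` by little. -/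
theorem exists_norm_value_sub_average_le {θ : Set.Icc (0 : ℝ) 1} (hθ₀ : 0 < (θ : ℝ))
    (hθ₁ : (θ : ℝ) < 1) (hX₀ : IsUMD X₀) (hS : IsCompactOperator S.T₀) {ε : ℝ} (hε : 0 < ε) :
    ∃ n : ℕ, ∀ a : ℤ →₀ X.inter, (∀ t, ‖trig (CalF.innerCoeff X a) t‖ ≤ 2) →
      (∀ t, ‖trig (CalF.outerCoeff X a) t‖ ≤ 2) →
      ‖S.mapInterp θ (X.value θ (CalF.laurent X (a - coeffMul (kernelCoeff n) a)))‖ ≤ ε := by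
  obtain ⟨η, hη, hval⟩ := Y.exists_norm_value_le hθ₀ hθ₁ (S.bound * 5) (half_pos hε)
  have hη3 : 0 < η / 3 := by positivity
  obtain ⟨N₀, hN₀⟩ := S.exists_innerMean_filter_ge_le hX₀ hS (M := 4) (by norm_num) hη3
  obtain ⟨R, hR, hcorr⟩ := S.exists_correction hX₀ hS (M := 4) (by norm_num) hη3
  have hdecay : ∀ α : ℝ, 0 < α → Tendsto (fun N : ℕ => Real.exp (α * ((-(N : ℤ) : ℤ) : ℝ))) atTop
      (𝓝 0) := fun α hα => by
    refine (Real.tendsto_exp_neg_atTop_nhds_zero.comp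
      (tendsto_natCast_atTop_atTop.const_mul_atTop hα)).congr fun N => ?_
    simp
  have hN1 : ∀ᶠ N : ℕ in atTop, R * (Real.exp ((-(N : ℤ) : ℤ) : ℝ) * geomBound 1) ≤ 1 := by
    have h := ((hdecay 1 one_pos).mul_const (geomBound 1)).const_mul R
    rw [zero_mul, mul_zero] at h
    filter_upwards [h.eventually (gt_mem_nhds one_pos)] with N hN
    rw [one_mul] at hN
    exact hN.le
  have hN2 : ∀ᶠ N : ℕ in atTop,
      S.bound * (R * (Real.exp (θ * ((-(N : ℤ) : ℤ) : ℝ)) * geomBound θ)) ≤ ε / 2 := by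
    have h := (((hdecay θ hθ₀).mul_const (geomBound θ)).const_mul R).const_mul S.bound
    rw [zero_mul, mul_zero, mul_zero] at h
    filter_upwards [h.eventually (gt_mem_nhds (half_pos hε))] with N hN using hN.le
  obtain ⟨N, hNN, hN1, hN2⟩ := ((eventually_ge_atTop N₀).and (hN1.and hN2)).exists
  have hmid : ∀ᶠ n : ℕ in atTop,
      S.bound * ∑ k ∈ Finset.Ico (-(N : ℤ)) N, ‖1 - kernelCoeff n k‖ * 2 ≤ η / 3 := by
    have h : Tendsto (fun n => S.bound * ∑ k ∈ Finset.Ico (-(N : ℤ)) N, ‖1 - kernelCoeff n k‖ * 2)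
        atTop (𝓝 (S.bound * ∑ k ∈ Finset.Ico (-(N : ℤ)) N, ‖(1 : ℂ) - 1‖ * 2)) :=
      (tendsto_finsetSum _ fun k _ =>
        ((tendsto_const_nhds.sub (tendsto_kernelCoeff k)).norm).mul_const 2).const_mul _
    simp only [sub_self, norm_zero, zero_mul, Finset.sum_const_zero, mul_zero] at h
    filter_upwards [h.eventually (gt_mem_nhds hη3)] with n hn using hn.le
  -- the kernel is chosen last: its coefficients have to be close to `1` on `[-N, N)`
  obtain ⟨n, hn⟩ := hmid.exists
  refine ⟨n, fun a ha₀ ha₁ => ?_⟩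
  set g := a - coeffMul (kernelCoeff n) a with hg
  have hg₀ : ∀ t, ‖trig (CalF.innerCoeff X g) t‖ ≤ 4 := fun t => by
    rw [hg, map_sub (CalF.innerCoeff X), map_sub, ContinuousMap.sub_apply]
    have := CalF.norm_trig_innerCoeff_coeffMul_le X ha₀ n t
    exact (norm_sub_le _ _).trans (by linarith [ha₀ t])
  have hg₁ : ∀ t, ‖trig (CalF.outerCoeff X g) t‖ ≤ 4 := fun t => by
    rw [hg, map_sub (CalF.outerCoeff X), map_sub, ContinuousMap.sub_apply]
    have := CalF.norm_trig_outerCoeff_coeffMul_le X ha₁ n t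
    exact (norm_sub_le _ _).trans (by linarith [ha₁ t])
  obtain ⟨u, huR, hu⟩ := hcorr g hg₀
  set v := u.filter (· < -(N : ℤ)) with hv
  have hvR : ∀ k, ‖v k‖ ≤ R := fun k => by
    rw [hv, Finsupp.filter_apply]
    split_ifs
    · exact huR k
    · simpa using hR
  have hvM : ∀ k ∈ v.support, k ≤ -(N : ℤ) := fun k hk => by
    rw [hv, Finsupp.support_filter, Finset.mem_filter] at hk
    exact hk.2.le
  -- only the frequencies `< -N` of `g` are corrected, by the same frequencies of `u`
  have hsplit : g - v = g.filter ((N : ℤ) ≤ ·) +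
      (g.filter (fun k => -(N : ℤ) ≤ k ∧ k < N) + (g - u).filter (· < -(N : ℤ))) := by
    ext1 k
    simp only [hv, Finsupp.sub_apply, Finsupp.add_apply, Finsupp.filter_apply]
    by_cases h1 : (N : ℤ) ≤ k
    · have h2 : ¬ k < -(N : ℤ) := by omega
      have h3 : ¬ (-(N : ℤ) ≤ k ∧ k < N) := by omega
      rw [if_pos h1, if_neg h2, if_neg h3, if_neg h2]; abel
    · by_cases h2 : k < -(N : ℤ)
      · have h3 : ¬ (-(N : ℤ) ≤ k ∧ k < N) := by omega
        rw [if_neg h1, if_pos h2, if_neg h3, if_pos h2]; abel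
      · have h3 : -(N : ℤ) ≤ k ∧ k < N := by omega
        rw [if_neg h1, if_neg h2, if_pos h3, if_neg h2]; abel
  have hmean : S.innerMean (g - v) ≤ η := by
    rw [hsplit]
    have e1 := hN₀ N hNN g hg₀ hg₁
    have e2 := hu (-(N : ℤ))
    have e3 : S.innerMean (g.filter (fun k => -(N : ℤ) ≤ k ∧ k < N)) ≤ η / 3 := by
      refine S.innerMean_le_of_forall fun t => ((S.norm_T₀_le _).trans
        (mul_le_mul_of_nonneg_left ?_ S.bound_nonneg)).trans hn
      refine (norm_trig_apply_le _ t).trans ?_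
      rw [CalF.innerCoeff_filter X g (fun k => -(N : ℤ) ≤ k ∧ k < N), Finsupp.sum_of_support_subset
        (s := Finset.Ico (-(N : ℤ)) N) _ (fun k hk => by
          rw [Finsupp.support_filter, Finset.mem_filter] at hk
          exact Finset.mem_Ico.2 hk.2) _ (by simp)]
      refine Finset.sum_le_sum fun k hk => ?_
      rw [Finsupp.filter_apply_pos (fun k => -(N : ℤ) ≤ k ∧ k < N) _ (Finset.mem_Ico.1 hk)]
      have e4 : CalF.innerCoeff X g k = (1 - kernelCoeff n k) • CalF.innerCoeff X a k := by
        rw [hg, CalF.innerCoeff_apply, CalF.innerCoeff_apply, Finsupp.sub_apply, coeffMul_apply,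
          map_sub, map_smul, sub_smul, one_smul]
      rw [e4, norm_smul]
      exact mul_le_mul_of_nonneg_left (norm_coeff_le_of_trig ha₀ k) (norm_nonneg _)
    have e5 := S.innerMean_add_le (g.filter ((N : ℤ) ≤ ·))
      (g.filter (fun k => -(N : ℤ) ≤ k ∧ k < N) + (g - u).filter (· < -(N : ℤ)))
    have e6 := S.innerMean_add_le (g.filter (fun k => -(N : ℤ) ≤ k ∧ k < N))
      ((g - u).filter (· < -(N : ℤ)))
    linarith
  have hw : ‖S.mapInterp θ (X.value θ (CalF.laurent X (g - v)))‖ ≤ ε / 2 := by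
    rw [mapInterp_value]
    refine hval _ ?_ fun t => ?_
    · simp only [inner_mapCalF, CalF.inner_laurent]
      exact hmean
    · rw [outer_mapCalF, CalF.outer_laurent]
      refine (S.norm_T₁_le _).trans (mul_le_mul_of_nonneg_left ?_ S.bound_nonneg)
      rw [map_sub (CalF.outerCoeff X), map_sub, ContinuousMap.sub_apply]
      have := norm_trig_outerCoeff_le hvR hvM t
      exact (norm_sub_le _ _).trans (by linarith [hg₁ t])
  have hvv := (S.norm_mapInterp_value_laurent_le hθ₀ hvR hvM).trans hN2
  have hgv : g = (g - v) + v := by abel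
  rw [hgv, map_add, map_add, map_add]
  exact (norm_add_le _ _).trans (by linarith)

/-- The operator from `𝓕(X)` to `[Y₀, Y₁]_θ` sending `f` to the image of the value at `e ^ θ` of its
`n`-th average; it involves only finitely many Laurent coefficients of `f`. -/
def averageOp (θ : Set.Icc (0 : ℝ) 1) (n : ℕ) : X.CalF →L[ℂ] Y.Interp θ :=
  ∑ k ∈ (kernelCoeff n).support,
    (((Real.exp (θ * k) : ℝ) : ℂ) * kernelCoeff n k) • (S.mapConst θ).comp (CalF.coeffCLM X k)

theorem averageOp_apply (θ : Set.Icc (0 : ℝ) 1) (n : ℕ) (f : X.CalF) :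
    S.averageOp θ n f = S.mapInterp θ (X.value θ
      (CalF.laurent X (coeffMul (kernelCoeff n) (CalF.coeff X f)))) := by
  rw [value_laurent, Finsupp.sum_of_support_subset _ (coeffMul_support _ _) _ (by simp), map_sum,
    averageOp, sum_apply]
  refine Finset.sum_congr rfl fun k _ => ?_
  rw [smul_apply, ContinuousLinearMap.comp_apply, CalF.coeffCLM_apply,
    mapConst_apply, coeffMul_apply]
  simp only [map_smul, smul_smul]

theorem isCompactOperator_averageOp {θ : Set.Icc (0 : ℝ) 1} (hθ₀ : 0 < (θ : ℝ))
    (hθ₁ : (θ : ℝ) < 1) (hS : IsCompactOperator S.T₀) (n : ℕ) :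
    IsCompactOperator (S.averageOp θ n) := by
  have h : S.averageOp θ n ∈ compactOperator (RingHom.id ℂ) X.CalF (Y.Interp θ) := by
    refine Submodule.sum_mem _ fun k _ => Submodule.smul_mem _ _ ?_
    exact (S.isCompactOperator_mapConst hθ₀ hθ₁ hS).comp_clm (CalF.coeffCLM X k)
  exact h

/-- The operator `f ↦ T (f (e ^ θ))` on `𝓕(X)`. -/
def mapValue (θ : Set.Icc (0 : ℝ) 1) : X.CalF →L[ℂ] Y.Interp θ :=
  (S.mapInterp θ).comp ((X.value θ).mkContinuous 1 fun f => (X.norm_value_le θ f).trans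
    (one_mul _).ge)

theorem mapValue_apply (θ : Set.Icc (0 : ℝ) 1) (f : X.CalF) :
    S.mapValue θ f = S.mapInterp θ (X.value θ f) := rfl

theorem exists_norm_mapValue_sub_averageOp_le {θ : Set.Icc (0 : ℝ) 1} (hθ₀ : 0 < (θ : ℝ))
    (hθ₁ : (θ : ℝ) < 1) (hX₀ : IsUMD X₀) (hS : IsCompactOperator S.T₀) {ε : ℝ} (hε : 0 < ε) :
    ∃ n : ℕ, ‖S.mapValue θ - S.averageOp θ n‖ ≤ ε := by
  obtain ⟨n, hn⟩ := S.exists_norm_value_sub_average_le hθ₀ hθ₁ hX₀ hS hε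
  refine ⟨n, ?_⟩
  have hlau : ∀ a : ℤ →₀ X.inter, ‖CalF.laurent X a‖ ≤ 2 →
      ‖(S.mapValue θ - S.averageOp θ n) (CalF.laurent X a)‖ ≤ ε := by
    intro a ha
    have e1 : coeffMul (kernelCoeff n) (CalF.coeff X (CalF.laurent X a)) =
        coeffMul (kernelCoeff n) a := by
      ext1 k; rw [coeffMul_apply, coeffMul_apply, CalF.coeff_laurent]
    rw [sub_apply, mapValue_apply, averageOp_apply, e1, ← map_sub, ← map_sub,
      ← map_sub]
    refine hn a (fun t => ?_) fun t => ?_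
    · rw [← CalF.inner_laurent]; exact (CalF.norm_inner_le X _ t).trans ha
    · rw [← CalF.outer_laurent]; exact (CalF.norm_outer_le X _ t).trans ha
  have hball : ∀ f : X.CalF, ‖f‖ ≤ 1 → ‖(S.mapValue θ - S.averageOp θ n) f‖ ≤ ε := by
    intro f hf
    have hlim := CalF.tendsto_laurent_coeff X f
    refine le_of_tendsto (((S.mapValue θ - S.averageOp θ n).continuous.norm.tendsto f).comp hlim) ?_
    filter_upwards [hlim.norm.eventually (gt_mem_nhds (hf.trans_lt one_lt_two))] with j hj
    exact hlau _ hj.le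
  refine ContinuousLinearMap.opNorm_le_bound _ hε.le fun f => ?_
  obtain ⟨f', hf', hf⟩ := exists_norm_le_one_eq_smul f
  conv_lhs => rw [hf]
  rw [map_smul, norm_smul, Complex.norm_real, norm_norm, mul_comm]
  exact mul_le_mul_of_nonneg_right (hball f' hf') (norm_nonneg _)

theorem isCompactOperator_mapInterp {θ : Set.Icc (0 : ℝ) 1} (hθ₀ : 0 < (θ : ℝ))
    (hθ₁ : (θ : ℝ) < 1) (hX₀ : IsUMD X₀) (hS : IsCompactOperator S.T₀) :
    IsCompactOperator (S.mapInterp θ) := by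
  have hval : IsCompactOperator (S.mapValue θ) := by
    have hcl := isClosed_setOfPred_isCompactOperator (σ₁₂ := RingHom.id ℂ) (M₁ := X.CalF)
      (M₂ := Y.Interp θ)
    refine hcl.closure_subset_iff.2 subset_rfl (Metric.mem_closure_iff.2 fun ε hε => ?_)
    obtain ⟨n, hn⟩ := S.exists_norm_mapValue_sub_averageOp_le hθ₀ hθ₁ hX₀ hS (half_pos hε)
    exact ⟨_, S.isCompactOperator_averageOp hθ₀ hθ₁ hS n,
      (dist_eq_norm _ _).trans_lt (hn.trans_lt (half_lt_self hε))⟩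
  rw [isCompactOperator_iff_exists_mem_nhds_isCompact_closure_image]
  refine ⟨Metric.ball 0 1, Metric.ball_mem_nhds _ one_pos, ?_⟩
  refine (IsCompactOperator.isCompact_closure_image_closedBall (f := (S.mapValue θ).toLinearMap)
    hval 2).of_isClosed_subset isClosed_closure (closure_mono ?_)
  rintro _ ⟨x, hx, rfl⟩
  rw [mem_ball_zero_iff] at hx
  obtain ⟨f, rfl, hf⟩ := ImageSpace.exists_mk_eq_norm_lt (X.evalAt θ) x one_pos
  exact ⟨f, mem_closedBall_zero_iff.2 (by linarith), rfl⟩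

end Hom
end BanachCouple
end

theorem theorem9
    {X₀ X₁ E Y₀ Y₁ F : Type*}
    [NormedAddCommGroup X₀] [NormedSpace ℂ X₀] [CompleteSpace X₀]
    [NormedAddCommGroup X₁] [NormedSpace ℂ X₁] [CompleteSpace X₁]
    [AddCommGroup E] [Module ℂ E] [TopologicalSpace E] [IsTopologicalAddGroup E]
    [ContinuousSMul ℂ E] [T2Space E]
    [NormedAddCommGroup Y₀] [NormedSpace ℂ Y₀] [CompleteSpace Y₀]
    [NormedAddCommGroup Y₁] [NormedSpace ℂ Y₁] [CompleteSpace Y₁]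
    [AddCommGroup F] [Module ℂ F] [TopologicalSpace F] [IsTopologicalAddGroup F]
    [ContinuousSMul ℂ F] [T2Space F]
    (X : BanachCouple X₀ X₁ E) (Y : BanachCouple Y₀ Y₁ F) (hX₀ : IsUMD X₀)
    (T : X.SumSpace →ₗ[ℂ] Y.SumSpace) (T₀ : X₀ →L[ℂ] Y₀) (T₁ : X₁ →L[ℂ] Y₁)
    (hT₀ : ∀ x, T (X.incl₀ x) = Y.incl₀ (T₀ x))
    (hT₁ : ∀ x, T (X.incl₁ x) = Y.incl₁ (T₁ x))
    (hcomp : IsCompactOperator T₀)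
    (θ : ℝ) (hθ₀ : 0 < θ) (hθ₁ : θ < 1) :
    ∃ Tθ : X.Interp ⟨θ, hθ₀.le, hθ₁.le⟩ →L[ℂ] Y.Interp ⟨θ, hθ₀.le, hθ₁.le⟩,
      (∀ x, Y.interpVal _ (Tθ x) = T (X.interpVal _ x)) ∧ IsCompactOperator Tθ := by
  let S : BanachCouple.Hom X Y := ⟨T, T₀, T₁, hT₀, hT₁⟩
  exact ⟨S.mapInterp _, S.interpVal_mapInterp _,
    S.isCompactOperator_mapInterp hθ₀ hθ₁ hX₀ hcomp⟩
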